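/- Let $M$ be a smooth (Hausdorff) $n$-dimensional manifold and let $(E,[\cdot,\cdot]_E,\sigma)$ be a Lie algebroid over $M$: $\pi:E\to M$ is a smooth real vector bundle of rank $m$, $\Gamma(E)$ carries a Lie bracket, and $\sigma:E\to TM$ is a smooth bundle map which induces a homomorphism of Lie algebras $\Gamma(E)\to\mathfrak X(M)$ and satisfies $[s,ft]_E=f[s,t]_E+(\sigma(s)f)\,t$. Let $\mathcal TE\to E$ be the prolongation of $E$, with fibres $$\mathcal T_wE=\{(u,X)\in E_{\pi(w)}\times T_wE \mid \sigma(u)=T_w\pi(X)\},$$ which is a Lie algebroid over $E$ with anchor $\sigma^1(u,X)=X$ and the bracket determined by $[(s\circ\pi,X),(t\circ\pi,Y)]=([s,t]_E\circ\pi,[X,Y])$ and the Leibniz rule. A section of $\mathcal TE$ acts on functions through $\sigma^1$; $d^E$ is the exterior derivative of $\mathcal TE$; vertical sections are those with first component $0$. For $a\in E_{\pi(w)}$ let $a^v_w\in T_wE$ be the velocity of $t\mapsto w+ta$ at $t=0$, and put $J(u,X)=(0,u^v_w)$ for $(u,X)\in\mathcal T_wE$ and $C(w)=(0,w^v_w)$.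 Let $U\subseteq E$ be open (for instance $U=E$ or $U=E$ without the zero section), and let $L:U\to\mathbb R$ be smooth and regular, i.e. the fibre Hessian $g_{\alpha\beta}=\partial^2L/\partial y^\alpha\partial y^\beta$ has rank $m$ at every point of $U$. Regard $g$ as a pseudo-Riemannian metric on vertical sections, $g(a^v,b^v)=g_{\alpha\beta}a^\alpha b^\beta$. Put $\theta_L=d^EL\circ J$, $\omega_L=d^E\theta_L$ and $E_L=C(L)-L$. Then: (i) there is exactly one smooth section $\mathcal S$ of $\mathcal TE$ over $U$ with $i_{\mathcal S}\omega_L=-d^EE_L$, and it is a semispray: $J\mathcal S=C$; (ii) $\mathcal N(\rho)=-[\mathcal S,J\rho]+J[\mathcal S,\rho]$ (that is, $\mathcal N=-\mathcal L_{\mathcal S}J$) is a nonlinear connection on $\mathcal TE$ over $U$, i.e. a smooth bundle endomorphism with $\mathcal N^2=\mathrm{Id}$ and $\ker(\mathrm{Id}+\mathcal N)$ the vertical subbundle; it is called the canonical nonlinear connection of $L$; (iii) $\mathcal N$ is metric: with $\mathrm h=\frac12(\mathrm{Id}+\mathcal N)$, $\mathrm v=\frac12(\mathrm{Id}-\mathcal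 N)$ and the dynamical covariant derivative $\nabla\rho=\mathrm h[\mathcal S,\mathrm h\rho]+\mathrm v[\mathcal S,\mathrm v\rho]$ one has $\nabla g=0$ on $U$, i.e. $$\mathcal S(g(\rho_1,\rho_2))=g(\nabla\rho_1,\rho_2)+g(\rho_1,\nabla\rho_2)$$ for all smooth vertical sections $\rho_1,\rho_2$ of $\mathcal TE$ over $U$. -/

import Mathlib

open Bundle Set Topology
open scoped Manifold ContDiff

noncomputable section

/-- The derivative `v(f)` of a real function on the base manifold along a tangent vector. -/
def baseDeriv {EM : Type*} [NormedAddCommGroup EM] [NormedSpace ℝ EM]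
    {M : Type*} [TopologicalSpace M] [ChartedSpace EM M]
    (f : M → ℝ) (x : M) (v : TangentSpace 𝓘(ℝ, EM) x) : ℝ :=
  mfderiv 𝓘(ℝ, EM) 𝓘(ℝ, ℝ) f x v

/-- A Lie algebroid structure on a smooth real vector bundle `E → M` (fibre model `F`) over a
manifold `M` modelled on `EM`: an anchor `σ : E → TM`, which is a smooth bundle map, and a Lie
bracket on the space `Γ(E)` of smooth sections, such that `σ` is a homomorphism of Lie algebras
and the Leibniz rule holds. -/
structure LieAlgebroid (EM : Type*) [NormedAddCommGroup EM] [NormedSpace ℝ EM]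
    {M : Type*} [TopologicalSpace M] [ChartedSpace EM M] [IsManifold 𝓘(ℝ, EM) ∞ M]
    (F : Type*) [NormedAddCommGroup F] [NormedSpace ℝ F]
    (E : M → Type*) [TopologicalSpace (TotalSpace F E)]
    [∀ x, AddCommGroup (E x)] [∀ x, Module ℝ (E x)] [∀ x, TopologicalSpace (E x)]
    [FiberBundle F E] [VectorBundle ℝ F E] where
  /-- the anchor, fibre by fibre -/
  anchor : ∀ x : M, E x →ₗ[ℝ] TangentSpace 𝓘(ℝ, EM) x
  anchor_smooth : ContMDiff (𝓘(ℝ, EM).prod 𝓘(ℝ, F)) 𝓘(ℝ, EM).tangent ∞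
    (fun u : TotalSpace F E ↦ (⟨u.proj, anchor u.proj u.2⟩ : TangentBundle 𝓘(ℝ, EM) M))
  /-- the bracket of smooth sections, an `ℝ`-bilinear operation -/
  bracket : Cₛ^∞⟮𝓘(ℝ, EM); F, E⟯ →ₗ[ℝ] Cₛ^∞⟮𝓘(ℝ, EM); F, E⟯ →ₗ[ℝ] Cₛ^∞⟮𝓘(ℝ, EM); F, E⟯
  bracket_skew : ∀ s t, bracket s t = - bracket t s
  jacobi : ∀ r s t,
    bracket r (bracket s t) + bracket s (bracket t r) + bracket t (bracket r s) = 0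
  anchor_bracket : ∀ s t, ∀ x : M, anchor x (bracket s t x) =
    VectorField.mlieBracket 𝓘(ℝ, EM) (fun y ↦ anchor y (s y)) (fun y ↦ anchor y (t y)) x
  /-- `[s, f t] = f [s, t] + (σ(s) f) t`; here `ft` is the section `f t` -/
  leibniz : ∀ (s t ft : Cₛ^∞⟮𝓘(ℝ, EM); F, E⟯) (f : M → ℝ),
    ContMDiff 𝓘(ℝ, EM) 𝓘(ℝ, ℝ) ∞ f → (∀ x, ft x = f x • t x) →
    ∀ x : M, bracket s ft x = f x • bracket s t x +
      baseDeriv f x (anchor x (s x)) • t x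

namespace LieAlgebroid

section VerticalLift

variable (EM : Type*) [NormedAddCommGroup EM] [NormedSpace ℝ EM]
  {M : Type*} [TopologicalSpace M] [ChartedSpace EM M]
  {F : Type*} [NormedAddCommGroup F] [NormedSpace ℝ F]
  {E : M → Type*} [TopologicalSpace (TotalSpace F E)]
  [∀ x, AddCommGroup (E x)] [∀ x, Module ℝ (E x)] [∀ x, TopologicalSpace (E x)]
  [FiberBundle F E]

/-- The vertical lift `a ↦ a_w^v`, from `E_x` to `T_w E` with `x = π(w)`: the velocity at `t = 0`
of the curve `t ↦ w + t a` in the fibre. -/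
def vlift (w : TotalSpace F E) (a : E w.proj) :
    TangentSpace (𝓘(ℝ, EM).prod 𝓘(ℝ, F)) w :=
  mfderiv 𝓘(ℝ, ℝ) (𝓘(ℝ, EM).prod 𝓘(ℝ, F))
    (fun t : ℝ ↦ (⟨w.proj, w.2 + t • a⟩ : TotalSpace F E)) 0 (1 : ℝ)

/-- The inverse of the vertical lift, defined on the vertical vectors at `w`. -/
def vcomp (w : TotalSpace F E) : TangentSpace (𝓘(ℝ, EM).prod 𝓘(ℝ, F)) w → E w.proj :=
  Function.invFun (vlift EM w)

/-- The derivative `X(f)` of a function on `E` in the direction of a tangent vector at `w`. -/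
def dirDeriv (f : TotalSpace F E → ℝ) (w : TotalSpace F E)
    (X : TangentSpace (𝓘(ℝ, EM).prod 𝓘(ℝ, F)) w) : ℝ :=
  mfderiv (𝓘(ℝ, EM).prod 𝓘(ℝ, F)) 𝓘(ℝ, ℝ) f w X

variable (F E) in
/-- Fields `w ↦ (u, X) ∈ E_{π(w)} × T_w E` on `E`, without further conditions. The sections of the
prolongation `𝒯E` are those which satisfy `IsSectionOn` below. -/
abbrev ProlField := ∀ w : TotalSpace F E, E w.proj × TangentSpace (𝓘(ℝ, EM).prod 𝓘(ℝ, F)) w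

/-- The vertical endomorphism `J(u, X) = (0, u^v)`. -/
def vertEndo (ρ : ProlField EM F E) : ProlField EM F E := fun w ↦ (0, vlift EM w (ρ w).1)

variable (F E) in
/-- The Euler section `C(w) = (0, w_w^v)`. -/
def euler : ProlField EM F E := fun w ↦ (0, vlift EM w w.2)

end VerticalLift

section FibreHessian

variable {M F : Type*} {E : M → Type*} [∀ x, AddCommGroup (E x)] [∀ x, Module ℝ (E x)]

/-- The Hessian `g_w(a, b)` of `L` along the fibre through `w`, with matrix
`g_{αβ} = ∂²L / ∂y^α ∂y^β` in linear fibre coordinates. -/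
def fibreHess (L : TotalSpace F E → ℝ) (w : TotalSpace F E) (a b : E w.proj) : ℝ :=
  deriv (fun s : ℝ ↦ deriv (fun t : ℝ ↦ L ⟨w.proj, w.2 + s • a + t • b⟩) 0) 0

/-- Regularity on `U`: the fibre Hessian has full rank at every point of `U`. -/
def IsRegularOn (L : TotalSpace F E → ℝ) (U : Set (TotalSpace F E)) : Prop :=
  ∀ w ∈ U, ∀ a : E w.proj, (∀ b : E w.proj, fibreHess L w a b = 0) → a = 0

end FibreHessian

section Prolongation

variable {EM : Type*} [NormedAddCommGroup EM] [NormedSpace ℝ EM] [FiniteDimensional ℝ EM]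
  {M : Type*} [TopologicalSpace M] [T2Space M] [ChartedSpace EM M] [IsManifold 𝓘(ℝ, EM) ∞ M]
  {F : Type*} [NormedAddCommGroup F] [NormedSpace ℝ F]
  {E : M → Type*} [TopologicalSpace (TotalSpace F E)]
  [∀ x, AddCommGroup (E x)] [∀ x, Module ℝ (E x)] [∀ x, TopologicalSpace (E x)]
  [FiberBundle F E] [VectorBundle ℝ F E] [ContMDiffVectorBundle ∞ F E 𝓘(ℝ, EM)]

variable (EM E) in
/-- Near `x`, a vector of the fibre model extends to a global smooth section of `E` which is
constant in the preferred trivialization at `x`. -/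
theorem exists_constSection (x : M) (f : F) : ∃ s : Cₛ^∞⟮𝓘(ℝ, EM); F, E⟯,
    ∀ᶠ y in 𝓝 x, s y = (trivializationAt F E x).symm y f := by
  set e := trivializationAt F E x with he
  have hx : e.baseSet ∈ 𝓝 x := e.open_baseSet.mem_nhds (mem_baseSet_trivializationAt F E x)
  obtain ⟨ψ, -, hψ⟩ := (SmoothBumpFunction.nhds_basis_tsupport (I := 𝓘(ℝ, EM)) x).mem_iff.1 hx
  have hsm : ContMDiffOn 𝓘(ℝ, EM) (𝓘(ℝ, EM).prod 𝓘(ℝ, F)) ∞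
      (fun y ↦ TotalSpace.mk' F y (e.symm y f)) e.baseSet := by
    rw [e.contMDiffOn_section_iff e.open_baseSet subset_rfl]
    refine (contMDiffOn_const (c := f)).congr fun y hy ↦ ?_
    rw [e.apply_mk_symm hy]
  refine ⟨⟨fun y ↦ ψ y • e.symm y f, ?_⟩, ?_⟩
  · exact ContMDiffOn.smul_section_of_tsupport ψ.contMDiff.contMDiffOn e.open_baseSet hψ hsm
  · filter_upwards [ψ.eventuallyEq_one] with y hy
    change ψ y • e.symm y f = _
    rw [hy, Pi.one_apply, one_smul]

variable (EM E) in
/-- A global smooth section which near `x` is the constant `f` in the trivialization at `x`. -/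
def constSection (x : M) (f : F) : Cₛ^∞⟮𝓘(ℝ, EM); F, E⟯ :=
  Classical.choose (exists_constSection EM E x f)

variable (A : LieAlgebroid EM F E)

/-- The fibre `𝒯_w E = {(u, X) ∈ E_x × T_w E | σ(u) = T_wπ(X)}`, `x = π(w)`, of the prolongation
of `E`. -/
def prolongation (w : TotalSpace F E) :
    Submodule ℝ (E w.proj × TangentSpace (𝓘(ℝ, EM).prod 𝓘(ℝ, F)) w) where
  carrier := {z | A.anchor w.proj z.1 = mfderiv (𝓘(ℝ, EM).prod 𝓘(ℝ, F)) 𝓘(ℝ, EM)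
    (TotalSpace.proj : TotalSpace F E → M) w z.2}
  add_mem' := by
    intro a b ha hb
    simp only [mem_ofPred_eq, Prod.fst_add, Prod.snd_add] at *
    rw [map_add, map_add, ha, hb]
  zero_mem' := by simp
  smul_mem' := by
    intro c a ha
    simp only [mem_ofPred_eq, Prod.smul_fst, Prod.smul_snd] at *
    rw [map_smul, map_smul, ha]

/-- `ρ` is a smooth section of the prolongation `𝒯E` over the open subset `U` of `E`. -/
structure IsSectionOn (U : Set (TotalSpace F E)) (ρ : ProlField EM F E) : Prop where
  mem : ∀ w ∈ U, ρ w ∈ A.prolongation w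
  smooth_fst : ContMDiffOn (𝓘(ℝ, EM).prod 𝓘(ℝ, F)) (𝓘(ℝ, EM).prod 𝓘(ℝ, F)) ∞
    (fun w ↦ (⟨w.proj, (ρ w).1⟩ : TotalSpace F E)) U
  smooth_snd : ContMDiffOn (𝓘(ℝ, EM).prod 𝓘(ℝ, F)) (𝓘(ℝ, EM).prod 𝓘(ℝ, F)).tangent ∞
    (fun w ↦ (⟨w, (ρ w).2⟩ : TangentBundle (𝓘(ℝ, EM).prod 𝓘(ℝ, F)) (TotalSpace F E))) U

/-- The first component `w ↦ (ρ w).1 ∈ E_{π(w)}` of a field, read in the preferred trivialization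
of `E` at `x`. -/
def fstCoord (x : M) (ρ : ProlField EM F E) (w : TotalSpace F E) : F :=
  (trivializationAt F E x ⟨w.proj, (ρ w).1⟩).2

/-- The derivative of `fstCoord x ρ` at `w` along a tangent vector `X` of `E` at `w`. -/
def fstCoordDeriv (x : M) (ρ : ProlField EM F E) (w : TotalSpace F E)
    (X : TangentSpace (𝓘(ℝ, EM).prod 𝓘(ℝ, F)) w) : F :=
  mfderiv (𝓘(ℝ, EM).prod 𝓘(ℝ, F)) 𝓘(ℝ, F) (fstCoord x ρ) w X

/-- The bracket `[ρ₁, ρ₂]` of sections of `𝒯E`. Its second component is the Lie bracket of the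
vector fields `X₁ = σ¹(ρ₁)`, `X₂ = σ¹(ρ₂)` on `E`. If the first components are `Z₁^α s_α`, `Z₂^α s_α`
in the frame `s_α` of the trivialization of `E` at `π(w)`, the first component of the bracket is
`(X₁(Z₂^γ) - X₂(Z₁^γ)) s_γ + Z₁^α Z₂^β [s_α, s_β]` at `w`. Hence for sections `(s ∘ π, X)` and
`(t ∘ π, Y)` with `s, t ∈ Γ(E)` the bracket is `([s, t] ∘ π, [X, Y])`. -/
def prolBracket (ρ₁ ρ₂ : ProlField EM F E) : ProlField EM F E := fun w ↦
  ((trivializationAt F E w.proj).symm w.proj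
      (fstCoordDeriv w.proj ρ₂ w (ρ₁ w).2 - fstCoordDeriv w.proj ρ₁ w (ρ₂ w).2) +
    A.bracket (constSection EM E w.proj (fstCoord w.proj ρ₁ w))
      (constSection EM E w.proj (fstCoord w.proj ρ₂ w)) w.proj,
   VectorField.mlieBracket (𝓘(ℝ, EM).prod 𝓘(ℝ, F)) (fun w' ↦ (ρ₁ w').2) (fun w' ↦ (ρ₂ w').2) w)

/-- A semispray on `U`: `J(S) = C`. -/
def IsSemisprayOn (U : Set (TotalSpace F E)) (S : ProlField EM F E) : Prop :=
  A.IsSectionOn U S ∧ ∀ w ∈ U, vertEndo EM S w = euler EM F E w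

/-- `P`, an operator on sections over `U`, is a nonlinear connection: a smooth bundle endomorphism
(that is, it maps sections to sections and is linear over smooth functions) with `P² = Id` and
`ker (Id + P)` equal to the vertical subbundle, which consists of the elements with first
component zero. -/
structure IsConnectionOn (U : Set (TotalSpace F E)) (P : ProlField EM F E → ProlField EM F E) : Prop where
  isSectionOn : ∀ ρ, A.IsSectionOn U ρ → A.IsSectionOn U (P ρ)
  map_add : ∀ ρ₁ ρ₂, A.IsSectionOn U ρ₁ → A.IsSectionOn U ρ₂ →
    ∀ w ∈ U, P (fun w' ↦ ρ₁ w' + ρ₂ w') w = P ρ₁ w + P ρ₂ w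
  map_smul : ∀ (f : TotalSpace F E → ℝ) (ρ : ProlField EM F E),
    ContMDiffOn (𝓘(ℝ, EM).prod 𝓘(ℝ, F)) 𝓘(ℝ, ℝ) ∞ f U → A.IsSectionOn U ρ →
    ∀ w ∈ U, P (fun w' ↦ f w' • ρ w') w = f w • P ρ w
  sq : ∀ ρ, A.IsSectionOn U ρ → ∀ w ∈ U, P (P ρ) w = ρ w
  ker : ∀ ρ, A.IsSectionOn U ρ → ∀ w ∈ U, (P ρ w = - ρ w ↔ (ρ w).1 = 0)

/-- The connection `𝒩 = -ℒ_S J` induced by `S`: `𝒩(ρ) = -[S, Jρ] + J[S, ρ]`. -/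
def conn (S ρ : ProlField EM F E) : ProlField EM F E := fun w ↦
  - A.prolBracket S (vertEndo EM ρ) w + vertEndo EM (A.prolBracket S ρ) w

/-- The horizontal projector `h = (Id + P) / 2` of a connection `P`. -/
def hproj (P : ProlField EM F E → ProlField EM F E) (ρ : ProlField EM F E) : ProlField EM F E := fun w ↦
  (1 / 2 : ℝ) • (ρ w + P ρ w)

/-- The vertical projector `v = (Id - P) / 2` of a connection `P`. -/
def vproj (P : ProlField EM F E → ProlField EM F E) (ρ : ProlField EM F E) : ProlField EM F E := fun w ↦
  (1 / 2 : ℝ) • (ρ w - P ρ w)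

/-- The dynamical covariant derivative of sections, `∇ρ = h[S, hρ] + v[S, vρ]`. -/
def dynCovDeriv (S : ProlField EM F E) (P : ProlField EM F E → ProlField EM F E) (ρ : ProlField EM F E) :
    ProlField EM F E := fun w ↦
  hproj P (A.prolBracket S (hproj P ρ)) w + vproj P (A.prolBracket S (vproj P ρ)) w

/-- The metric `g = g_{αβ} 𝒱^α ⊗ 𝒱^β` on vertical sections induced by `L`. -/
def metric (L : TotalSpace F E → ℝ) (ρ₁ ρ₂ : ProlField EM F E) (w : TotalSpace F E) : ℝ :=
  fibreHess L w (vcomp EM w (ρ₁ w).2) (vcomp EM w (ρ₂ w).2)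

/-- `(∇g)(ρ₁, ρ₂) = S(g(ρ₁, ρ₂)) - g(∇ρ₁, ρ₂) - g(ρ₁, ∇ρ₂)`. -/
def dynCovDerivMetric (L : TotalSpace F E → ℝ) (S : ProlField EM F E)
    (P : ProlField EM F E → ProlField EM F E) (ρ₁ ρ₂ : ProlField EM F E) (w : TotalSpace F E) : ℝ :=
  dirDeriv EM (metric L ρ₁ ρ₂) w (S w).2 - metric L (A.dynCovDeriv S P ρ₁) ρ₂ w -
    metric L ρ₁ (A.dynCovDeriv S P ρ₂) w

/-- The connection `P` is metric on `U`: `∇g = 0` on all vertical sections over `U`. -/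
def IsMetricOn (U : Set (TotalSpace F E)) (L : TotalSpace F E → ℝ) (S : ProlField EM F E)
    (P : ProlField EM F E → ProlField EM F E) : Prop :=
  ∀ ρ₁ ρ₂ : ProlField EM F E, A.IsSectionOn U ρ₁ → A.IsSectionOn U ρ₂ →
    (∀ w ∈ U, (ρ₁ w).1 = 0) → (∀ w ∈ U, (ρ₂ w).1 = 0) →
    ∀ w ∈ U, A.dynCovDerivMetric L S P ρ₁ ρ₂ w = 0

/-- The Cartan 1-section `θ_L = J(d^E L)`: `θ_L(ρ) = (d^E L)(Jρ)`. -/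
def cartanOne (L : TotalSpace F E → ℝ) (ρ : ProlField EM F E) (w : TotalSpace F E) : ℝ :=
  dirDeriv EM L w (vertEndo EM ρ w).2

/-- The Cartan 2-section `ω_L = d^E θ_L`:
`ω_L(ρ₁, ρ₂) = ρ₁(θ_L(ρ₂)) - ρ₂(θ_L(ρ₁)) - θ_L([ρ₁, ρ₂])`. -/
def cartanTwo (L : TotalSpace F E → ℝ) (ρ₁ ρ₂ : ProlField EM F E) (w : TotalSpace F E) : ℝ :=
  dirDeriv EM (cartanOne L ρ₂) w (ρ₁ w).2 - dirDeriv EM (cartanOne L ρ₁) w (ρ₂ w).2 -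
    cartanOne L (A.prolBracket ρ₁ ρ₂) w

variable (EM) in
/-- The energy `E_L = C(L) - L`, that is `y^α ∂L/∂y^α - L`. -/
def energy (L : TotalSpace F E → ℝ) (w : TotalSpace F E) : ℝ :=
  dirDeriv EM L w (euler EM F E w).2 - L w

/-- `S` is a section of `𝒯E` over `U` with `i_S ω_L = - d^E E_L`. The equality of these two forms
is tested on local sections. -/
def IsLagrangianSectionOn (U : Set (TotalSpace F E)) (L : TotalSpace F E → ℝ)
    (S : ProlField EM F E) : Prop :=
  A.IsSectionOn U S ∧ ∀ V ⊆ U, IsOpen V → ∀ ρ : ProlField EM F E, A.IsSectionOn V ρ →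
    ∀ w ∈ V, A.cartanTwo L S ρ w = - dirDeriv EM (energy EM L) w (ρ w).2

end Prolongation

end LieAlgebroid

end

/-!
In a chart `(x, y)` of `E` adapted to a trivialization, a section of the prolongation over `U` has
coordinates `(f, v)`, with second component `(σ f, v)`. Nondegeneracy of the fibre Hessian of `L`
turns `i_S ω_L = -d E_L` into `f = y` together with the Euler–Lagrange equation, which determines
`v`; the local solutions therefore agree on overlaps and glue to the unique `S`, a semispray. In the
same coordinates `-ℒ_S J` is `(f, v) ↦ (f, N f - v)` with a linear map `N`, an involution whose
`-1`-eigenspace is `f = 0`. Differentiating the Euler–Lagrange equation along the fibre and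
symmetrizing expresses the derivative of the Hessian along `S` through `N`; this is `∇g = 0`.
-/

noncomputable section

namespace LieAlgebroid

section Calculus

variable {X F : Type*} [NormedAddCommGroup X] [NormedSpace ℝ X]
  [NormedAddCommGroup F] [NormedSpace ℝ F] {ℓ : X × F → ℝ} {q : X × F} {n : ℕ∞}

/-- The fibre derivative `∂ℓ/∂y` of a function of `(x, y)`. -/
def momentum (ℓ : X × F → ℝ) (q : X × F) : F →L[ℝ] ℝ :=
  (fderiv ℝ ℓ q).comp (.inr ℝ X F)

/-- The second fibre derivative `∂²ℓ/∂y∂y` of a function of `(x, y)`. -/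
def fibreHessian (ℓ : X × F → ℝ) (q : X × F) : F →L[ℝ] F →L[ℝ] ℝ :=
  (fderiv ℝ (momentum ℓ) q).comp (.inr ℝ X F)

theorem contDiffAt_momentum (hℓ : ContDiffAt ℝ (n + 1) ℓ q) : ContDiffAt ℝ n (momentum ℓ) q :=
  (hℓ.fderiv_right le_rfl).clm_comp contDiffAt_const

theorem contDiffAt_fibreHessian (hℓ : ContDiffAt ℝ (n + 1 + 1) ℓ q) :
    ContDiffAt ℝ n (fibreHessian ℓ) q :=
  ((contDiffAt_momentum (n := n + 1) hℓ).fderiv_right le_rfl).clm_comp contDiffAt_const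

theorem differentiableAt_momentum (hℓ : ContDiffAt ℝ 2 ℓ q) : DifferentiableAt ℝ (momentum ℓ) q :=
  (contDiffAt_momentum (n := 1) hℓ).differentiableAt one_ne_zero

theorem fderiv_momentum_apply (hℓ : ContDiffAt ℝ 2 ℓ q) (v : X × F) (b : F) :
    fderiv ℝ (momentum ℓ) q v b = fderiv ℝ (fderiv ℝ ℓ) q v (0, b) := by
  have hdℓ : DifferentiableAt ℝ (fderiv ℝ ℓ) q :=
    (hℓ.fderiv_right (m := 1) le_rfl).differentiableAt one_ne_zero
  have h := hdℓ.hasFDerivAt.clm_comp (hasFDerivAt_const (.inr ℝ X F) q)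
  rw [show fderiv ℝ (momentum ℓ) q = _ from h.fderiv]
  simp

theorem fderiv_fderiv_comm {G : Type*} [NormedAddCommGroup G] [NormedSpace ℝ G] {f : X × F → G}
    (hf : ContDiffAt ℝ 2 f q) (v w : X × F) :
    fderiv ℝ (fderiv ℝ f) q v w = fderiv ℝ (fderiv ℝ f) q w v :=
  hf.isSymmSndFDerivAt (by simp) v w

theorem fibreHessian_comm (hℓ : ContDiffAt ℝ 2 ℓ q) (a b : F) :
    fibreHessian ℓ q a b = fibreHessian ℓ q b a := by
  simp only [fibreHessian, ContinuousLinearMap.comp_apply, fderiv_momentum_apply hℓ]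
  exact fderiv_fderiv_comm hℓ _ _

theorem fderiv_fibreHessian_apply (hℓ : ContDiffAt ℝ 3 ℓ q) (v : X × F) (a : F) :
    fderiv ℝ (fibreHessian ℓ) q v a = fderiv ℝ (fderiv ℝ (momentum ℓ)) q v (0, a) := by
  have hdp : DifferentiableAt ℝ (fderiv ℝ (momentum ℓ)) q :=
    ((contDiffAt_momentum (n := 2) hℓ).fderiv_right (m := 1) le_rfl).differentiableAt one_ne_zero
  have h := hdp.hasFDerivAt.clm_comp (hasFDerivAt_const (.inr ℝ X F) q)
  rw [show fderiv ℝ (fibreHessian ℓ) q = _ from h.fderiv]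
  simp

theorem fderiv_fibreHessian_comm (hℓ : ContDiffAt ℝ 3 ℓ q) (v : X × F) (a b : F) :
    fderiv ℝ (fibreHessian ℓ) q v a b = fderiv ℝ (fibreHessian ℓ) q v b a := by
  have hH : DifferentiableAt ℝ (fibreHessian ℓ) q :=
    (contDiffAt_fibreHessian (n := 1) hℓ).differentiableAt one_ne_zero
  have hab (a b : F) : HasFDerivAt (fun q' ↦ fibreHessian ℓ q' a b)
      (((fderiv ℝ (fibreHessian ℓ) q).flip a).flip b) q := by
    refine ((hH.hasFDerivAt.clm_apply (hasFDerivAt_const a q)).clm_apply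
      (hasFDerivAt_const b q)).congr_fderiv ?_
    ext <;> simp
  have hsymm : (fun q' ↦ fibreHessian ℓ q' a b) =ᶠ[𝓝 q] fun q' ↦ fibreHessian ℓ q' b a := by
    filter_upwards [(hℓ.of_le (m := 2) (by norm_num)).eventually (by simp)] with q' hq'
      using fibreHessian_comm hq' a b
  exact DFunLike.congr_fun (((hab a b).congr_of_eventuallyEq hsymm.symm).unique (hab b a)) v

/-- The Euler-Lagrange equation at `q = (x, y)` for the fibre component `v` of a semispray. The
maps `σ` and `c` are the anchor and the bracket of the algebroid over `x`, read in a local frame. -/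
def EulerLagrangeAt (σ : F →L[ℝ] X) (c : F →L[ℝ] F →L[ℝ] F) (ℓ : X × F → ℝ) (q : X × F)
    (v : F) : Prop :=
  ∀ f, fderiv ℝ (momentum ℓ) q (σ q.2, v) f - momentum ℓ q (c q.2 f) = fderiv ℝ ℓ q (σ f, 0)

/-- The solution of the Euler-Lagrange equation for the fibre component of the semispray. -/
def lagrangeForce (σ : F →L[ℝ] X) (c : F →L[ℝ] F →L[ℝ] F) (ℓ : X × F → ℝ) (q : X × F) : F :=
  (fibreHessian ℓ q).inverse (((fderiv ℝ ℓ q).comp (.inl ℝ X F)).comp σ +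
    (momentum ℓ q).comp (c q.2) - fderiv ℝ (momentum ℓ) q (σ q.2, 0))

theorem fderiv_momentum_prodMk (x : X) (v : F) :
    fderiv ℝ (momentum ℓ) q (x, v) = fderiv ℝ (momentum ℓ) q (x, 0) + fibreHessian ℓ q v := by
  rw [fibreHessian, ContinuousLinearMap.comp_apply, ContinuousLinearMap.inr_apply, ← map_add,
    Prod.mk_add_mk, add_zero, zero_add]

/-- Testing `i_S ω = -dE` on vertical vectors gives `z = y`, testing on the others gives the
Euler-Lagrange equation. -/
theorem forall_cartan_eq_iff_eulerLagrangeAt {σ : F →L[ℝ] X} {c : F →L[ℝ] F →L[ℝ] F}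
    (hℓ : ContDiffAt ℝ 2 ℓ q) (hreg : Function.Injective (fibreHessian ℓ q)) {z v : F} :
    (∀ f u, fderiv ℝ (momentum ℓ) q (σ z, v) f - fderiv ℝ (momentum ℓ) q (σ f, u) z -
        momentum ℓ q (c z f) =
      -(fderiv ℝ (momentum ℓ) q (σ f, u) q.2 - fderiv ℝ ℓ q (σ f, 0))) ↔
    z = q.2 ∧ EulerLagrangeAt σ c ℓ q v := by
  constructor
  · intro h
    obtain rfl : z = q.2 := hreg <| ContinuousLinearMap.ext fun u ↦ by
      have hu := h 0 u
      simp only [fderiv_momentum_prodMk _ u, map_zero, Prod.mk_zero_zero, zero_add, sub_zero,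
        zero_sub, neg_inj] at hu
      rw [fibreHessian_comm hℓ, hu, fibreHessian_comm hℓ]
    exact ⟨rfl, fun f ↦ by linarith [h f 0]⟩
  · rintro ⟨rfl, hEL⟩ f u
    linarith [hEL f]

theorem hasFDerivAt_comp_prodMk_right {G : Type*} [NormedAddCommGroup G] [NormedSpace ℝ G]
    {f : X × F → G} (hf : DifferentiableAt ℝ f q) :
    HasFDerivAt (fun y ↦ f (q.1, y)) ((fderiv ℝ f q).comp (.inr ℝ X F)) q.2 :=
  hf.hasFDerivAt.comp q.2 (hasFDerivAt_prodMk_right q.1 q.2)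

theorem fderiv_eulerLagrange {σ : F →L[ℝ] X} {c : F →L[ℝ] F →L[ℝ] F} {s : F → F} {s' : F →L[ℝ] F}
    (hℓ : ContDiffAt ℝ 3 ℓ q) (hs : HasFDerivAt s s' q.2)
    (hEL : ∀ᶠ y in 𝓝 q.2, EulerLagrangeAt σ c ℓ (q.1, y) (s y)) (a b : F) :
    fderiv ℝ (fibreHessian ℓ) q (σ q.2, s q.2) a b + fderiv ℝ (momentum ℓ) q (σ a, 0) b +
        fibreHessian ℓ q (s' a) b - (fibreHessian ℓ q a (c q.2 b) + momentum ℓ q (c a b)) =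
      fderiv ℝ (momentum ℓ) q (σ b, 0) a := by
  have hℓ₂ : ContDiffAt ℝ 2 ℓ q := hℓ.of_le (by norm_num)
  have hp₂ : ContDiffAt ℝ 2 (momentum ℓ) q := contDiffAt_momentum (n := 2) hℓ
  have hp := hasFDerivAt_comp_prodMk_right (differentiableAt_momentum hℓ₂)
  have hdp := hasFDerivAt_comp_prodMk_right
    ((hp₂.fderiv_right (m := 1) le_rfl).differentiableAt one_ne_zero)
  have hdℓ := hasFDerivAt_comp_prodMk_right
    ((hℓ₂.fderiv_right (m := 1) le_rfl).differentiableAt one_ne_zero)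
  have hinertia := (hdp.clm_apply (σ.hasFDerivAt.prodMk hs)).clm_apply (hasFDerivAt_const b q.2)
  have hbracket := hp.clm_apply ((c.flip b).hasFDerivAt (x := q.2))
  have hforce := hdℓ.clm_apply (hasFDerivAt_const ((σ b, 0) : X × F) q.2)
  have h := DFunLike.congr_fun (((hinertia.sub hbracket).congr_of_eventuallyEq
    (hEL.mono fun y hy ↦ (hy b).symm)).unique hforce) a
  simp only [Prod.mk.eta, sub_apply, add_apply, ContinuousLinearMap.comp_apply,
    ContinuousLinearMap.flip_apply, ContinuousLinearMap.prod_apply, zero_apply, map_zero, zero_add,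
    ContinuousLinearMap.inr_apply] at h
  rw [fderiv_momentum_prodMk, fderiv_fderiv_comm hp₂, ← fderiv_fibreHessian_apply hℓ,
    fderiv_fderiv_comm hℓ₂, ← fderiv_momentum_apply hℓ₂] at h
  rw [← h]
  simp only [add_apply, fibreHessian, ContinuousLinearMap.comp_apply, ContinuousLinearMap.inr_apply]
  ring

/-- Symmetrize the derivative of the Euler-Lagrange equation along the fibre. -/
theorem two_mul_fderiv_fibreHessian {σ : F →L[ℝ] X} {c : F →L[ℝ] F →L[ℝ] F} {s : F → F}
    {s' : F →L[ℝ] F} (hc : ∀ f f', c f f' = -c f' f) (hℓ : ContDiffAt ℝ 3 ℓ q)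
    (hs : HasFDerivAt s s' q.2) (hEL : ∀ᶠ y in 𝓝 q.2, EulerLagrangeAt σ c ℓ (q.1, y) (s y))
    (a b : F) :
    2 * fderiv ℝ (fibreHessian ℓ) q (σ q.2, s q.2) a b =
      fibreHessian ℓ q (c q.2 a - s' a) b + fibreHessian ℓ q a (c q.2 b - s' b) := by
  have hsymm := fibreHessian_comm (hℓ.of_le (by norm_num : (2 : WithTop ℕ∞) ≤ 3))
  have hab := fderiv_eulerLagrange hℓ hs hEL a b
  have hba := fderiv_eulerLagrange hℓ hs hEL b a
  rw [fderiv_fibreHessian_comm hℓ, hc b a, map_neg, hsymm b, hsymm _ a] at hba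
  rw [hsymm _ b, map_sub, map_sub, hsymm b, hsymm b]
  linarith

theorem exists_coe_eq_fibreHessian [FiniteDimensional ℝ F]
    (hreg : Function.Injective (fibreHessian ℓ q)) :
    ∃ e : F ≃L[ℝ] (F →L[ℝ] ℝ), (e : F →L[ℝ] F →L[ℝ] ℝ) = fibreHessian ℓ q := by
  have hdim : Module.finrank ℝ F = Module.finrank ℝ (F →L[ℝ] ℝ) := by
    rw [← (LinearMap.toContinuousLinearMap (𝕜 := ℝ) (E := F) (F' := ℝ)).finrank_eq]
    exact Subspace.dual_finrank_eq.symm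
  exact ⟨(LinearEquiv.ofInjectiveOfFinrankEq _ hreg hdim).toContinuousLinearEquiv, rfl⟩

theorem eulerLagrangeAt_iff_fibreHessian_eq {σ : F →L[ℝ] X} {c : F →L[ℝ] F →L[ℝ] F} {v : F} :
    EulerLagrangeAt σ c ℓ q v ↔ fibreHessian ℓ q v = ((fderiv ℝ ℓ q).comp (.inl ℝ X F)).comp σ +
      (momentum ℓ q).comp (c q.2) - fderiv ℝ (momentum ℓ) q (σ q.2, 0) := by
  simp only [EulerLagrangeAt, ContinuousLinearMap.ext_iff, fderiv_momentum_prodMk _ v, add_apply,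
    sub_apply, ContinuousLinearMap.comp_apply, ContinuousLinearMap.inl_apply]
  exact forall_congr' fun f ↦ ⟨fun h ↦ by linarith, fun h ↦ by linarith⟩

theorem eulerLagrangeAt_iff_eq_lagrangeForce [FiniteDimensional ℝ F]
    (hreg : Function.Injective (fibreHessian ℓ q)) {σ : F →L[ℝ] X} {c : F →L[ℝ] F →L[ℝ] F} {v : F} :
    EulerLagrangeAt σ c ℓ q v ↔ v = lagrangeForce σ c ℓ q := by
  obtain ⟨e, he⟩ := exists_coe_eq_fibreHessian hreg
  rw [eulerLagrangeAt_iff_fibreHessian_eq, lagrangeForce, ← he, ContinuousLinearMap.inverse_equiv]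
  exact e.eq_symm_apply.symm

theorem contDiffAt_lagrangeForce [FiniteDimensional ℝ F] {σ : X × F → F →L[ℝ] X}
    {c : X × F → F →L[ℝ] F →L[ℝ] F} (hℓ : ContDiffAt ℝ (n + 1 + 1) ℓ q)
    (hσ : ContDiffAt ℝ n σ q) (hc : ContDiffAt ℝ n c q)
    (hreg : Function.Injective (fibreHessian ℓ q)) :
    ContDiffAt ℝ n (fun q' ↦ lagrangeForce (σ q') (c q') ℓ q') q := by
  obtain ⟨e, he⟩ := exists_coe_eq_fibreHessian hreg
  have hinv : ContDiffAt ℝ n (fun q' ↦ (fibreHessian ℓ q').inverse) q := by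
    have h := contDiffAt_map_inverse (n := n) e
    rw [he] at h
    exact h.comp q (contDiffAt_fibreHessian hℓ)
  have hℓ₁ : ContDiffAt ℝ (n + 1) ℓ q := hℓ.of_le le_self_add
  have hp := contDiffAt_momentum hℓ₁
  have hdp := (contDiffAt_momentum (n := n + 1) hℓ).fderiv_right (m := n) le_rfl
  exact hinv.clm_apply
    (((((hℓ₁.fderiv_right le_rfl).clm_comp contDiffAt_const).clm_comp hσ).add
      (hp.clm_comp (hc.clm_apply contDiffAt_snd))).sub
        (hdp.clm_apply ((hσ.clm_apply contDiffAt_snd).prodMk contDiffAt_const)))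

theorem contDiffAt_of_forall_apply {G : Type*} [NormedAddCommGroup G] [NormedSpace ℝ G]
    [FiniteDimensional ℝ F] {f : X → F →L[ℝ] G} {x : X} {n : ℕ∞ω}
    (hf : ∀ b, ContDiffAt ℝ n (fun x' ↦ f x' b) x) : ContDiffAt ℝ n f x := by
  let b := Module.finBasis ℝ F
  have hexpand : f = fun x' ↦ ∑ i, (b.coord i).toContinuousLinearMap.smulRight (f x' (b i)) := by
    ext x' y
    conv_lhs => rw [← b.sum_repr y]
    simp [-Module.Basis.sum_repr]
  rw [hexpand]
  exact ContDiffAt.sum fun i _ ↦ contDiffAt_const.smulRight (hf (b i))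

end Calculus

section Chart

variable {G : Type*} [NormedAddCommGroup G] [NormedSpace ℝ G]
  {H : Type*} [TopologicalSpace H] {I : ModelWithCorners ℝ G H}
  {N : Type*} [TopologicalSpace N] [ChartedSpace H N]
  {G' : Type*} [NormedAddCommGroup G'] [NormedSpace ℝ G'] {p₀ p : N} {q : G}

variable (I) in
/-- The derivative at `p` of the chart centred at `p₀`. -/
def chartDeriv (p₀ p : N) : TangentSpace I p →L[ℝ] G := mfderiv I 𝓘(ℝ, G) (extChartAt I p₀) p

variable (I) in
/-- The derivative at `q` of the inverse of the chart centred at `p₀`. -/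
def chartDerivSymm (p₀ : N) (q : G) : G →L[ℝ] TangentSpace I ((extChartAt I p₀).symm q) :=
  mfderiv 𝓘(ℝ, G) I (extChartAt I p₀).symm q

/-- A vector field read in the chart centred at `p₀`. -/
def chartVectorField (p₀ : N) (X : ∀ p : N, TangentSpace I p) (q : G) : G :=
  chartDeriv I p₀ ((extChartAt I p₀).symm q) (X ((extChartAt I p₀).symm q))

theorem chartDeriv_injective [IsManifold I 1 N] (hp : p ∈ (extChartAt I p₀).source) :
    Function.Injective (chartDeriv I p₀ p) :=
  (isInvertible_mfderiv_extChartAt hp).injective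

theorem trivializationAt_tangentSpace_apply [IsManifold I 1 N]
    (hp : p ∈ (extChartAt I p₀).source)
    (v : TangentSpace I p) :
    (trivializationAt G (TangentSpace I) p₀ ⟨p, v⟩).2 = chartDeriv I p₀ p v := by
  rw [extChartAt_source] at hp
  rw [chartDeriv, ← TangentBundle.continuousLinearMapAt_trivializationAt hp]
  exact (congrFun (Trivialization.coe_linearMapAt_of_mem (R := ℝ) _ hp) v).symm

variable [I.Boundaryless]

theorem eventually_extChartAt_symm_mem {U : Set N} (hU : IsOpen U)
    (hq : q ∈ (extChartAt I p₀).target) (hqU : (extChartAt I p₀).symm q ∈ U) :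
    ∀ᶠ q' in 𝓝 q, q' ∈ (extChartAt I p₀).target ∧ (extChartAt I p₀).symm q' ∈ U :=
  ((isOpen_extChartAt_target p₀).eventually_mem hq).and
    ((continuousAt_extChartAt_symm'' hq).eventually (hU.eventually_mem hqU))

theorem contMDiffAt_symm_iff {n : ℕ∞ω} [IsManifold I n N] {f : N → G'}
    (hq : q ∈ (extChartAt I p₀).target) :
    ContMDiffAt I 𝓘(ℝ, G') n f ((extChartAt I p₀).symm q) ↔
      ContDiffAt ℝ n (f ∘ (extChartAt I p₀).symm) q := by
  have hp := (extChartAt I p₀).map_target hq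
  rw [extChartAt_source] at hp
  rw [contMDiffAt_iff_source_of_mem_source hp, I.range_eq_univ, contMDiffWithinAt_univ,
    (extChartAt I p₀).right_inv hq, contMDiffAt_iff_contDiffAt]

theorem contMDiffAt_extChartAt_symm {n : ℕ∞ω} [IsManifold I n N]
    (hq : q ∈ (extChartAt I p₀).target) : ContMDiffAt 𝓘(ℝ, G) I n (extChartAt I p₀).symm q :=
  (contMDiffOn_extChartAt_symm p₀).contMDiffAt ((isOpen_extChartAt_target p₀).mem_nhds hq)

section Derivative

variable [IsManifold I 1 N]

theorem mdifferentiableAt_symm_iff {f : N → G'} (hq : q ∈ (extChartAt I p₀).target) :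
    MDifferentiableAt I 𝓘(ℝ, G') f ((extChartAt I p₀).symm q) ↔
      DifferentiableAt ℝ (f ∘ (extChartAt I p₀).symm) q := by
  have hp := (extChartAt I p₀).map_target hq
  rw [extChartAt_source] at hp
  rw [mdifferentiableAt_iff_source_of_mem_source hp, I.range_eq_univ, mdifferentiableWithinAt_univ,
    (extChartAt I p₀).right_inv hq, mdifferentiableAt_iff_differentiableAt]

theorem chartDeriv_comp_chartDerivSymm (hq : q ∈ (extChartAt I p₀).target) :
    (chartDeriv I p₀ ((extChartAt I p₀).symm q)).comp (chartDerivSymm I p₀ q) = .id ℝ G := by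
  have h := mfderiv_extChartAt_comp_mfderivWithin_extChartAt_symm (I := I) hq
  rw [I.range_eq_univ, mfderivWithin_univ] at h
  exact h

theorem chartDerivSymm_comp_chartDeriv (hq : q ∈ (extChartAt I p₀).target) :
    (chartDerivSymm I p₀ q).comp (chartDeriv I p₀ ((extChartAt I p₀).symm q)) =
      .id ℝ (TangentSpace I ((extChartAt I p₀).symm q)) := by
  have h := mfderivWithin_extChartAt_symm_comp_mfderiv_extChartAt (I := I) hq
  rw [I.range_eq_univ, mfderivWithin_univ] at h
  exact h

theorem chartDerivSymm_chartDeriv (hq : q ∈ (extChartAt I p₀).target)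
    (v : TangentSpace I ((extChartAt I p₀).symm q)) :
    chartDerivSymm I p₀ q (chartDeriv I p₀ ((extChartAt I p₀).symm q) v) = v :=
  DFunLike.congr_fun (chartDerivSymm_comp_chartDeriv hq) v

theorem mfderiv_symm_apply {f : N → G'} (hq : q ∈ (extChartAt I p₀).target)
    (hf : DifferentiableAt ℝ (f ∘ (extChartAt I p₀).symm) q)
    (v : TangentSpace I ((extChartAt I p₀).symm q)) :
    mfderiv I 𝓘(ℝ, G') f ((extChartAt I p₀).symm q) v =
      fderiv ℝ (f ∘ (extChartAt I p₀).symm) q (chartDeriv I p₀ _ v) := by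
  have h := mfderiv_comp q ((mdifferentiableAt_symm_iff hq).2 hf)
    ((contMDiffAt_extChartAt_symm (n := 1) hq).mdifferentiableAt one_ne_zero)
  rw [mfderiv_eq_fderiv] at h
  rw [h]
  exact congrArg _ (chartDerivSymm_chartDeriv hq v).symm

theorem mpullback_extChartAt_symm (hq : q ∈ (extChartAt I p₀).target)
    (X : ∀ p : N, TangentSpace I p) :
    VectorField.mpullback 𝓘(ℝ, G) I (extChartAt I p₀).symm X q = chartVectorField p₀ X q := by
  rw [VectorField.mpullback_apply, chartVectorField]
  exact DFunLike.congr_fun (ContinuousLinearMap.inverse_eq (chartDerivSymm_comp_chartDeriv hq)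
    (chartDeriv_comp_chartDerivSymm hq)) _

end Derivative

theorem contMDiffAt_vectorField_symm_iff [IsManifold I ∞ N] (X : ∀ p : N, TangentSpace I p)
    (hq : q ∈ (extChartAt I p₀).target) :
    ContMDiffAt I I.tangent ∞ (fun p ↦ (⟨p, X p⟩ : TangentBundle I N))
        ((extChartAt I p₀).symm q) ↔ ContDiffAt ℝ ∞ (chartVectorField p₀ X) q := by
  have hp := (extChartAt I p₀).map_target hq
  rw [(trivializationAt G (TangentSpace I) p₀).contMDiffAt_section_iff
    (by rwa [TangentBundle.trivializationAt_baseSet, ← extChartAt_source I]),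
    contMDiffAt_symm_iff hq, ← contMDiffAt_iff_contDiffAt, ← contMDiffAt_iff_contDiffAt]
  refine Filter.EventuallyEq.contMDiffAt_iff ?_
  filter_upwards [(isOpen_extChartAt_target p₀).mem_nhds hq] with z hz
    using trivializationAt_tangentSpace_apply ((extChartAt I p₀).map_target hz) _

theorem mdifferentiableAt_vectorField_symm_iff [IsManifold I 2 N] (X : ∀ p : N, TangentSpace I p)
    (hq : q ∈ (extChartAt I p₀).target) :
    MDifferentiableAt I I.tangent (fun p ↦ (⟨p, X p⟩ : TangentBundle I N))
        ((extChartAt I p₀).symm q) ↔ DifferentiableAt ℝ (chartVectorField p₀ X) q := by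
  have hp := (extChartAt I p₀).map_target hq
  rw [(trivializationAt G (TangentSpace I) p₀).mdifferentiableAt_section_iff I X
    (by rwa [TangentBundle.trivializationAt_baseSet, ← extChartAt_source I]),
    mdifferentiableAt_symm_iff hq]
  refine Filter.EventuallyEq.differentiableAt_iff ?_
  filter_upwards [(isOpen_extChartAt_target p₀).mem_nhds hq] with z hz
    using trivializationAt_tangentSpace_apply ((extChartAt I p₀).map_target hz) _

theorem chartVectorField_mlieBracket [CompleteSpace G] [IsManifold I 2 N]
    {X Y : ∀ p : N, TangentSpace I p} (hq : q ∈ (extChartAt I p₀).target)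
    (hX : DifferentiableAt ℝ (chartVectorField p₀ X) q)
    (hY : DifferentiableAt ℝ (chartVectorField p₀ Y) q) :
    chartVectorField p₀ (VectorField.mlieBracket I X Y) q =
      fderiv ℝ (chartVectorField p₀ Y) q (chartVectorField p₀ X q) -
        fderiv ℝ (chartVectorField p₀ X) q (chartVectorField p₀ Y q) := by
  have hI : IsManifold I (minSmoothness ℝ 2) N := by simpa
  have hpullback (Z : ∀ p : N, TangentSpace I p) :
      VectorField.mpullback 𝓘(ℝ, G) I (extChartAt I p₀).symm Z =ᶠ[𝓝 q] chartVectorField p₀ Z := by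
    filter_upwards [(isOpen_extChartAt_target p₀).mem_nhds hq] with z hz
      using mpullback_extChartAt_symm hz Z
  rw [← mpullback_extChartAt_symm hq, VectorField.mpullback_mlieBracket
    ((mdifferentiableAt_vectorField_symm_iff X hq).2 hX)
    ((mdifferentiableAt_vectorField_symm_iff Y hq).2 hY)
    (contMDiffAt_extChartAt_symm (n := 2) hq) (by simp),
    (hpullback X).mlieBracket_vectorField_eq (hpullback Y)]
  exact congrFun (VectorField.mlieBracketWithin_eq_lieBracketWithin.trans
    VectorField.lieBracketWithin_univ) q

end Chart

section BundleCoordinates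

variable {EM : Type*} [NormedAddCommGroup EM] [NormedSpace ℝ EM]
  {M : Type*} [TopologicalSpace M] [ChartedSpace EM M]
  {F : Type*} [NormedAddCommGroup F] [NormedSpace ℝ F]
  {E : M → Type*} [TopologicalSpace (TotalSpace F E)]
  [∀ x, TopologicalSpace (E x)] [FiberBundle F E]
  {x₀ x : M} {w₀ w : TotalSpace F E} {q : EM × F}

local notation "𝓘E" => ModelWithCorners.prod 𝓘(ℝ, EM) 𝓘(ℝ, F)

theorem mem_extChartAt_source_iff :
    w ∈ (extChartAt 𝓘E w₀).source ↔ w.proj ∈ (extChartAt 𝓘(ℝ, EM) w₀.proj).source ∧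
      w.proj ∈ (trivializationAt F E w₀.proj).baseSet := by
  rw [FiberBundle.extChartAt, PartialEquiv.trans_source, and_comm]
  simp only [mem_inter_iff, mem_preimage, PartialEquiv.prod_source, mem_prod,
    PartialEquiv.refl_source, mem_univ, and_true, Trivialization.coe_coe,
    OpenPartialHomeomorph.toFun_eq_coe]
  change w ∈ (trivializationAt F E w₀.proj).source ∧
    (trivializationAt F E w₀.proj w).1 ∈ _ ↔ _
  rw [Trivialization.mem_source]
  refine and_congr_right fun hw ↦ ?_
  rw [Trivialization.coe_fst' _ hw]

theorem proj_symm_mem_baseSet (hq : q ∈ (extChartAt 𝓘E w₀).target) :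
    ((extChartAt 𝓘E w₀).symm q).proj ∈ (trivializationAt F E w₀.proj).baseSet :=
  (mem_extChartAt_source_iff.1 ((extChartAt 𝓘E w₀).map_target hq)).2

theorem mem_extChartAt_target_iff :
    q ∈ (extChartAt 𝓘E w₀).target ↔ q.1 ∈ (extChartAt 𝓘(ℝ, EM) w₀.proj).target ∧
      (extChartAt 𝓘(ℝ, EM) w₀.proj).symm q.1 ∈ (trivializationAt F E w₀.proj).baseSet := by
  rw [FiberBundle.extChartAt_target]
  simp

variable [∀ x, AddCommGroup (E x)] [∀ x, Module ℝ (E x)] [VectorBundle ℝ F E]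

variable (F E) in
/-- The fibre coordinates over `x` in the preferred trivialization at `x₀`. -/
def fibCoord (x₀ x : M) : E x →ₗ[ℝ] F := (trivializationAt F E x₀).linearMapAt ℝ x

variable (F E) in
/-- The vector over `x` with given fibre coordinates in the preferred trivialization at `x₀`. -/
def fibSymm (x₀ x : M) : F →ₗ[ℝ] E x := (trivializationAt F E x₀).symmₗ ℝ x

theorem trivializationAt_apply_snd (hx : x ∈ (trivializationAt F E x₀).baseSet) (a : E x) :
    (trivializationAt F E x₀ ⟨x, a⟩).2 = fibCoord F E x₀ x a := by
  rw [fibCoord, Trivialization.coe_linearMapAt_of_mem _ hx]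

theorem trivializationAt_symm (hx : x ∈ (trivializationAt F E x₀).baseSet) (f : F) :
    (trivializationAt F E x₀).symm x f = fibSymm F E x₀ x f := by
  rw [fibSymm, Trivialization.symmₗ_apply _ hx]

theorem fibCoord_fibSymm (hx : x ∈ (trivializationAt F E x₀).baseSet) (f : F) :
    fibCoord F E x₀ x (fibSymm F E x₀ x f) = f :=
  Trivialization.linearMapAt_symmₗ _ hx f

theorem fibSymm_fibCoord (hx : x ∈ (trivializationAt F E x₀).baseSet) (a : E x) :
    fibSymm F E x₀ x (fibCoord F E x₀ x a) = a :=
  Trivialization.symmₗ_linearMapAt _ hx a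

theorem fibCoord_injective (hx : x ∈ (trivializationAt F E x₀).baseSet) :
    Function.Injective (fibCoord F E x₀ x) :=
  Function.LeftInverse.injective (fibSymm_fibCoord hx)

theorem extChartAt_apply (hw : w.proj ∈ (trivializationAt F E w₀.proj).baseSet) :
    extChartAt 𝓘E w₀ w =
      (extChartAt 𝓘(ℝ, EM) w₀.proj w.proj, fibCoord F E w₀.proj w.proj w.2) := by
  rw [FiberBundle.extChartAt, ← trivializationAt_apply_snd hw]
  change (extChartAt 𝓘(ℝ, EM) w₀.proj (trivializationAt F E w₀.proj w).1,
    (trivializationAt F E w₀.proj w).2) = _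
  rw [Trivialization.coe_fst' _ hw]

theorem extChartAt_symm_apply (hq : q ∈ (extChartAt 𝓘E w₀).target) :
    (extChartAt 𝓘E w₀).symm q = ⟨(extChartAt 𝓘(ℝ, EM) w₀.proj).symm q.1,
      fibSymm F E w₀.proj ((extChartAt 𝓘(ℝ, EM) w₀.proj).symm q.1) q.2⟩ := by
  have h := (mem_extChartAt_target_iff.1 hq).2
  rw [← trivializationAt_symm h, FiberBundle.extChartAt]
  exact ((trivializationAt F E w₀.proj).mk_symm h q.2).symm

theorem fibCoord_extChartAt_symm (hq : q ∈ (extChartAt 𝓘E w₀).target) :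
    fibCoord F E w₀.proj _ ((extChartAt 𝓘E w₀).symm q).2 = q.2 := by
  have h := extChartAt_apply (EM := EM) (proj_symm_mem_baseSet hq)
  rw [(extChartAt 𝓘E w₀).right_inv hq] at h
  exact (congrArg Prod.snd h).symm

theorem extChartAt_add_smul (hw : w.proj ∈ (trivializationAt F E w₀.proj).baseSet) (a : E w.proj)
    (t : ℝ) :
    extChartAt 𝓘E w₀ ⟨w.proj, w.2 + t • a⟩ =
      extChartAt 𝓘E w₀ w + t • ((0, fibCoord F E w₀.proj w.proj a) : EM × F) := by
  rw [extChartAt_apply hw, extChartAt_apply (w := ⟨w.proj, w.2 + t • a⟩) hw]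
  simp

theorem contMDiff_fibreLine (w : TotalSpace F E) (a : E w.proj) :
    ContMDiff 𝓘(ℝ, ℝ) 𝓘E ∞ (fun t : ℝ ↦ (⟨w.proj, w.2 + t • a⟩ : TotalSpace F E)) := by
  intro t
  rw [contMDiffAt_totalSpace]
  refine ⟨contMDiffAt_const, ?_⟩
  simp only [trivializationAt_apply_snd (mem_baseSet_trivializationAt F E w.proj), map_add,
    map_smul]
  rw [contMDiffAt_iff_contDiffAt]
  fun_prop

theorem mfderiv_vlift {G : Type*} [NormedAddCommGroup G] [NormedSpace ℝ G]
    {f : TotalSpace F E → G} (hf : MDifferentiableAt 𝓘E 𝓘(ℝ, G) f w) (a : E w.proj) :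
    mfderiv 𝓘E 𝓘(ℝ, G) f w (vlift EM w a) =
      deriv (fun t : ℝ ↦ f ⟨w.proj, w.2 + t • a⟩) 0 := by
  have hzero : (⟨w.proj, w.2 + (0 : ℝ) • a⟩ : TotalSpace F E) = w := by rw [zero_smul, add_zero]
  have h := mfderiv_comp_of_eq hf ((contMDiff_fibreLine w a).mdifferentiableAt (by simp)) hzero
  rw [mfderiv_eq_fderiv] at h
  let D (p : TotalSpace F E) : EM × F →L[ℝ] G := mfderiv 𝓘E 𝓘(ℝ, G) f p
  exact (DFunLike.congr_fun (congrArg D hzero) _).symm.trans (DFunLike.congr_fun h (1 : ℝ)).symm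

variable [IsManifold 𝓘(ℝ, EM) ∞ M] [ContMDiffVectorBundle ∞ F E 𝓘(ℝ, EM)]

theorem chartDeriv_mfderiv_proj (hw : w ∈ (extChartAt 𝓘E w₀).source) (X : TangentSpace 𝓘E w) :
    chartDeriv 𝓘(ℝ, EM) w₀.proj w.proj
        (mfderiv 𝓘E 𝓘(ℝ, EM) (TotalSpace.proj : TotalSpace F E → M) w X) =
      (chartDeriv 𝓘E w₀ w X).1 := by
  have hproj : MDifferentiableAt 𝓘E 𝓘(ℝ, EM) (TotalSpace.proj : TotalSpace F E → M) w :=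
    (contMDiff_proj (n := ∞) E).mdifferentiableAt (by simp)
  have hbase : MDifferentiableAt 𝓘(ℝ, EM) 𝓘(ℝ, EM) (extChartAt 𝓘(ℝ, EM) w₀.proj) w.proj :=
    mdifferentiableAt_extChartAt (by simpa using (mem_extChartAt_source_iff.1 hw).1)
  have htotal : MDifferentiableAt 𝓘E 𝓘(ℝ, EM × F) (extChartAt 𝓘E w₀) w :=
    mdifferentiableAt_extChartAt (by simpa only [extChartAt_source] using hw)
  have hcomm : extChartAt 𝓘(ℝ, EM) w₀.proj ∘ TotalSpace.proj =ᶠ[𝓝 w]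
      (Prod.fst : EM × F → EM) ∘ extChartAt 𝓘E w₀ := by
    filter_upwards [(isOpen_extChartAt_source w₀).mem_nhds hw] with z hz
    exact (congrArg Prod.fst (extChartAt_apply (mem_extChartAt_source_iff.1 hz).2)).symm
  have h := hcomm.mfderiv_eq (I := 𝓘E) (I' := 𝓘(ℝ, EM))
  rw [mfderiv_comp w hbase hproj, mfderiv_comp w differentiableAt_fst.mdifferentiableAt htotal,
    mfderiv_eq_fderiv, fderiv_fst] at h
  exact DFunLike.congr_fun h X

theorem chartDeriv_vlift (hw : w ∈ (extChartAt 𝓘E w₀).source) (a : E w.proj) :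
    chartDeriv 𝓘E w₀ w (vlift EM w a) = (0, fibCoord F E w₀.proj w.proj a) := by
  have hchart : MDifferentiableAt 𝓘E 𝓘(ℝ, EM × F) (extChartAt 𝓘E w₀) w :=
    mdifferentiableAt_extChartAt (by simpa only [extChartAt_source] using hw)
  have hline (t : ℝ) := extChartAt_add_smul (EM := EM) (mem_extChartAt_source_iff.1 hw).2 a t
  refine (mfderiv_vlift hchart a).trans ?_
  simp only [hline]
  exact (((hasDerivAt_id (0 : ℝ)).smul_const
    ((0, fibCoord F E w₀.proj w.proj a) : EM × F)).const_add _).deriv.trans (one_smul ℝ _)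

theorem vlift_injective (w : TotalSpace F E) : Function.Injective (vlift EM w) := by
  intro a b hab
  have hw : w ∈ (extChartAt 𝓘E w).source := mem_extChartAt_source w
  have h := congrArg (chartDeriv 𝓘E w w) hab
  rw [chartDeriv_vlift hw, chartDeriv_vlift hw] at h
  exact fibCoord_injective (mem_baseSet_trivializationAt F E w.proj) (congrArg Prod.snd h)

theorem fibCoord_vcomp (hw : w ∈ (extChartAt 𝓘E w₀).source) {X : TangentSpace 𝓘E w}
    (hX : (chartDeriv 𝓘E w₀ w X).1 = 0) :
    fibCoord F E w₀.proj w.proj (vcomp EM w X) = (chartDeriv 𝓘E w₀ w X).2 := by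
  have hw' := (mem_extChartAt_source_iff.1 hw).2
  have hlift : vlift EM w (fibSymm F E w₀.proj w.proj (chartDeriv 𝓘E w₀ w X).2) = X := by
    apply chartDeriv_injective hw
    rw [chartDeriv_vlift hw, fibCoord_fibSymm hw', ← hX]
  conv_lhs => rw [← hlift, vcomp, Function.leftInverse_invFun (vlift_injective w)]
  exact fibCoord_fibSymm hw' _

end BundleCoordinates

section LocalFrames

variable {EM : Type*} [NormedAddCommGroup EM] [NormedSpace ℝ EM]
  {M : Type*} [TopologicalSpace M] [ChartedSpace EM M]
  {F : Type*} [NormedAddCommGroup F] [NormedSpace ℝ F]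
  {E : M → Type*} [TopologicalSpace (TotalSpace F E)]
  [∀ x, AddCommGroup (E x)] [∀ x, Module ℝ (E x)] [∀ x, TopologicalSpace (E x)]
  [FiberBundle F E] [VectorBundle ℝ F E]
  {x₀ x : M} {s t u : Cₛ^∞⟮𝓘(ℝ, EM); F, E⟯}

/-- The derivative of the coordinates of a section of `E` in the trivialization at `x₀`. -/
def secDeriv (x₀ : M) (s : Cₛ^∞⟮𝓘(ℝ, EM); F, E⟯) (x : M) : TangentSpace 𝓘(ℝ, EM) x →L[ℝ] F :=
  mfderiv 𝓘(ℝ, EM) 𝓘(ℝ, F) (fun y ↦ fibCoord F E x₀ y (s y)) x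

/-- The product of a smooth function and a smooth section. -/
def smulSection (f : C^∞⟮𝓘(ℝ, EM), M; 𝓘(ℝ, ℝ), ℝ⟯) (s : Cₛ^∞⟮𝓘(ℝ, EM); F, E⟯) :
    Cₛ^∞⟮𝓘(ℝ, EM); F, E⟯ :=
  ⟨fun x ↦ f x • s x, f.contMDiff.smul_section s.contMDiff⟩

theorem sum_section_apply {ι : Type*} (S : Finset ι) (s : ι → Cₛ^∞⟮𝓘(ℝ, EM); F, E⟯) (x : M) :
    (∑ i ∈ S, s i) x = ∑ i ∈ S, s i x := by
  rw [← ContMDiffSection.coeAddHom_apply, map_sum, Finset.sum_apply]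
  rfl

theorem contMDiffAt_fibCoord_section [ContMDiffVectorBundle ∞ F E 𝓘(ℝ, EM)]
    (s : Cₛ^∞⟮𝓘(ℝ, EM); F, E⟯) (hx : x ∈ (trivializationAt F E x₀).baseSet) :
    ContMDiffAt 𝓘(ℝ, EM) 𝓘(ℝ, F) ∞ (fun y ↦ fibCoord F E x₀ y (s y)) x := by
  refine (((trivializationAt F E x₀).contMDiffAt_section_iff hx).1
    (s.contMDiff x)).congr_of_eventuallyEq ?_
  filter_upwards [(trivializationAt F E x₀).open_baseSet.mem_nhds hx] with y hy
  exact (trivializationAt_apply_snd hy _).symm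

theorem secDeriv_sub [ContMDiffVectorBundle ∞ F E 𝓘(ℝ, EM)]
    (hx : x ∈ (trivializationAt F E x₀).baseSet) (s t : Cₛ^∞⟮𝓘(ℝ, EM); F, E⟯) :
    secDeriv x₀ (s - t) x = secDeriv x₀ s x - secDeriv x₀ t x := by
  have hd (r : Cₛ^∞⟮𝓘(ℝ, EM); F, E⟯) :
      MDifferentiableAt 𝓘(ℝ, EM) 𝓘(ℝ, F) (fun y ↦ fibCoord F E x₀ y (r y)) x :=
    (contMDiffAt_fibCoord_section r hx).mdifferentiableAt (by simp)
  have hsub : (fun y ↦ fibCoord F E x₀ y ((s - t) y)) =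
      (fun y ↦ fibCoord F E x₀ y (s y)) - fun y ↦ fibCoord F E x₀ y (t y) :=
    funext fun y ↦ map_sub (fibCoord F E x₀ y) (s y) (t y)
  exact (((hd s).hasMFDerivAt.sub (hd t).hasMFDerivAt).congr_of_eventuallyEq
    (.of_eq hsub)).mfderiv

section Smooth

variable [IsManifold 𝓘(ℝ, EM) ∞ M] (A : LieAlgebroid EM F E)

theorem bracket_sum_smulSection {ι : Type*} (S : Finset ι)
    (f : ι → C^∞⟮𝓘(ℝ, EM), M; 𝓘(ℝ, ℝ), ℝ⟯) (e : ι → Cₛ^∞⟮𝓘(ℝ, EM); F, E⟯) :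
    A.bracket s (∑ i ∈ S, smulSection (f i) (e i)) x = ∑ i ∈ S,
      (f i x • A.bracket s (e i) x + baseDeriv (f i) x (A.anchor x (s x)) • e i x) := by
  rw [map_sum, sum_section_apply]
  exact Finset.sum_congr rfl fun i _ ↦
    A.leibniz s (e i) (smulSection (f i) (e i)) (f i) (f i).contMDiff (fun _ ↦ rfl) x

variable [FiniteDimensional ℝ EM] [T2Space M]

theorem exists_contMDiff_eventuallyEq {f : M → ℝ}
    (hf : ∀ᶠ y in 𝓝 x, ContMDiffAt 𝓘(ℝ, EM) 𝓘(ℝ, ℝ) ∞ f y) :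
    ∃ g : C^∞⟮𝓘(ℝ, EM), M; 𝓘(ℝ, ℝ), ℝ⟯, g =ᶠ[𝓝 x] f := by
  obtain ⟨ψ, -, hψ⟩ := (SmoothBumpFunction.nhds_basis_tsupport (I := 𝓘(ℝ, EM)) x).mem_iff.1 hf
  refine ⟨⟨fun y ↦ ψ y • f y, contMDiff_of_tsupport fun y hy ↦
    ψ.contMDiffAt.smul (hψ (tsupport_smul_subset_left _ _ hy))⟩, ?_⟩
  filter_upwards [ψ.eventuallyEq_one] with y hy
  exact (congrArg (· • f y) hy).trans (one_smul ℝ _)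

theorem bracket_eq_zero_of_eventually (hu : ∀ᶠ y in 𝓝 x, u y = 0) : A.bracket s u x = 0 := by
  obtain ⟨ψ, -, hψ⟩ := (SmoothBumpFunction.nhds_basis_tsupport (I := 𝓘(ℝ, EM)) x).mem_iff.1 hu
  have hmul (y : M) : u y = (1 - ψ y) • u y := by
    by_cases hy : y ∈ tsupport ψ
    · rw [show u y = 0 from hψ hy, smul_zero]
    · rw [image_eq_zero_of_notMem_tsupport hy, sub_zero, one_smul]
  rw [A.leibniz s u u (fun y ↦ 1 - ψ y) (contMDiff_const.sub ψ.contMDiff) hmul x,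
    hu.self_of_nhds, smul_zero, add_zero, ψ.eq_one, sub_self, zero_smul]

theorem bracket_congr_right (h : ∀ᶠ y in 𝓝 x, t y = u y) :
    A.bracket s t x = A.bracket s u x := by
  have hsub : A.bracket s (t - u) x = 0 :=
    A.bracket_eq_zero_of_eventually (h.mono fun y hy ↦ sub_eq_zero.2 hy)
  rw [map_sub, ContMDiffSection.coe_sub, Pi.sub_apply] at hsub
  exact sub_eq_zero.1 hsub

variable [ContMDiffVectorBundle ∞ F E 𝓘(ℝ, EM)]

theorem constSection_eventually_eq (x : M) (f : F) :
    ∀ᶠ y in 𝓝 x, constSection EM E x f y = fibSymm F E x y f := by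
  filter_upwards [Classical.choose_spec (exists_constSection EM E x f),
    (trivializationAt F E x).open_baseSet.mem_nhds (mem_baseSet_trivializationAt F E x)]
    with y hy hyx
  exact hy.trans (trivializationAt_symm hyx f)

theorem constSection_self (x : M) (f : F) :
    constSection EM E x f x = fibSymm F E x x f :=
  (constSection_eventually_eq x f).self_of_nhds

theorem secDeriv_constSection_self (x : M) (f : F) :
    secDeriv x (constSection EM E x f) x = 0 := by
  have hconst : (fun y ↦ fibCoord F E x y (constSection EM E x f y)) =ᶠ[𝓝 x] fun _ ↦ f := by
    filter_upwards [constSection_eventually_eq (EM := EM) (E := E) x f,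
      (trivializationAt F E x).open_baseSet.mem_nhds (mem_baseSet_trivializationAt F E x)]
      with y hy hyx
    rw [hy, fibCoord_fibSymm hyx]
  rw [secDeriv, hconst.mfderiv_eq, mfderiv_const]
  rfl

variable [FiniteDimensional ℝ F]

variable (EM E) in
/-- The linear extension of `f ↦ constSection EM E x₀ f` from a basis of the fibre model. -/
def frameSection (x₀ : M) : F →ₗ[ℝ] Cₛ^∞⟮𝓘(ℝ, EM); F, E⟯ :=
  (Module.finBasis ℝ F).constr ℝ fun i ↦ constSection EM E x₀ (Module.finBasis ℝ F i)

variable (EM F E) in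
/-- The points of the chart domain and the trivialization domain at `x₀` near which
`frameSection EM E x₀` is the frame of the trivialization. -/
def frameSet (x₀ : M) : Set M :=
  {x | ∀ᶠ y in 𝓝 x, y ∈ (trivializationAt F E x₀).baseSet ∧
    y ∈ (extChartAt 𝓘(ℝ, EM) x₀).source ∧ ∀ f, frameSection EM E x₀ f y = fibSymm F E x₀ y f}

theorem isOpen_frameSet (x₀ : M) : IsOpen (frameSet EM F E x₀) :=
  isOpen_setOfPred_eventually_nhds

theorem mem_frameSet_self (x₀ : M) : x₀ ∈ frameSet EM F E x₀ := by
  filter_upwards [(trivializationAt F E x₀).open_baseSet.mem_nhds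
    (mem_baseSet_trivializationAt F E x₀), extChartAt_source_mem_nhds (I := 𝓘(ℝ, EM)) x₀,
    Filter.eventually_all.2 fun i ↦ constSection_eventually_eq (EM := EM) (E := E) x₀
      (Module.finBasis ℝ F i)] with y hbase hsource hframe
  refine ⟨hbase, hsource, fun f ↦ ?_⟩
  conv_rhs => rw [← (Module.finBasis ℝ F).sum_repr f, map_sum]
  rw [frameSection, Module.Basis.constr_apply_fintype, sum_section_apply]
  refine Finset.sum_congr rfl fun i _ ↦ ?_
  rw [map_smul, ← hframe i]
  rfl

theorem mem_baseSet_of_mem_frameSet (hx : x ∈ frameSet EM F E x₀) :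
    x ∈ (trivializationAt F E x₀).baseSet :=
  (Filter.Eventually.self_of_nhds hx).1

theorem mem_source_of_mem_frameSet (hx : x ∈ frameSet EM F E x₀) :
    x ∈ (extChartAt 𝓘(ℝ, EM) x₀).source :=
  (Filter.Eventually.self_of_nhds hx).2.1

theorem fibCoord_frameSection (hx : x ∈ frameSet EM F E x₀) (f : F) :
    fibCoord F E x₀ x (frameSection EM E x₀ f x) = f := by
  rw [(Filter.Eventually.self_of_nhds hx).2.2 f,
    fibCoord_fibSymm (mem_baseSet_of_mem_frameSet hx)]

theorem secDeriv_frameSection (hx : x ∈ frameSet EM F E x₀) (f : F) :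
    secDeriv x₀ (frameSection EM E x₀ f) x = 0 := by
  have hconst : (fun y ↦ fibCoord F E x₀ y (frameSection EM E x₀ f y)) =ᶠ[𝓝 x] fun _ ↦ f := by
    filter_upwards [(isOpen_frameSet x₀).mem_nhds hx] with y hy using fibCoord_frameSection hy f
  rw [secDeriv, hconst.mfderiv_eq, mfderiv_const]
  rfl

theorem exists_eventually_eq_sum_smulSection (u : Cₛ^∞⟮𝓘(ℝ, EM); F, E⟯)
    (hx : x ∈ frameSet EM F E x₀) :
    ∃ f : Fin (Module.finrank ℝ F) → C^∞⟮𝓘(ℝ, EM), M; 𝓘(ℝ, ℝ), ℝ⟯,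
      (∀ j, f j =ᶠ[𝓝 x] fun y ↦ (Module.finBasis ℝ F).repr (fibCoord F E x₀ y (u y)) j) ∧
      ∀ᶠ y in 𝓝 x,
        u y = (∑ j, smulSection (f j) (frameSection EM E x₀ (Module.finBasis ℝ F j))) y := by
  set b := Module.finBasis ℝ F
  have hsmooth (j) : ∀ᶠ y in 𝓝 x, ContMDiffAt 𝓘(ℝ, EM) 𝓘(ℝ, ℝ) ∞
      (fun y ↦ b.repr (fibCoord F E x₀ y (u y)) j) y := by
    filter_upwards [(isOpen_frameSet x₀).mem_nhds hx] with y hy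
    exact (b.coord j).toContinuousLinearMap.contMDiff.contMDiffAt.comp y
      (contMDiffAt_fibCoord_section u (mem_baseSet_of_mem_frameSet hy))
  choose f hf using fun j ↦ exists_contMDiff_eventuallyEq (hsmooth j)
  refine ⟨f, hf, ?_⟩
  filter_upwards [Filter.eventually_all.2 hf, (isOpen_frameSet x₀).mem_nhds hx] with y hfy hy
  apply fibCoord_injective (mem_baseSet_of_mem_frameSet hy)
  rw [sum_section_apply, map_sum]
  conv_lhs => rw [← b.sum_repr (fibCoord F E x₀ y (u y))]
  refine Finset.sum_congr rfl fun j _ ↦ ?_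
  rw [← hfy j]
  exact (((fibCoord F E x₀ y).map_smul _ _).trans
    (congrArg (f j y • ·) (fibCoord_frameSection hy (b j)))).symm

theorem fibCoord_bracket_of_apply_eq_zero (hx : x ∈ frameSet EM F E x₀) (hu : u x = 0) :
    fibCoord F E x₀ x (A.bracket s u x) = secDeriv x₀ u x (A.anchor x (s x)) := by
  obtain ⟨f, hf, hsum⟩ := exists_eventually_eq_sum_smulSection u hx
  set b := Module.finBasis ℝ F
  have hfx (j) : f j x = 0 := by
    refine (hf j).self_of_nhds.trans ?_
    simp only [hu, map_zero, Finsupp.zero_apply]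
  have hderiv (j) (v : TangentSpace 𝓘(ℝ, EM) x) :
      baseDeriv (f j) x v = b.repr (secDeriv x₀ u x v) j := by
    let φ := (b.coord j).toContinuousLinearMap
    have h := mfderiv_comp x (g := φ) φ.differentiableAt.mdifferentiableAt
      ((contMDiffAt_fibCoord_section u (mem_baseSet_of_mem_frameSet hx)).mdifferentiableAt
        (by simp))
    rw [mfderiv_eq_fderiv, φ.fderiv] at h
    rw [baseDeriv, (hf j).mfderiv_eq]
    exact DFunLike.congr_fun h v
  rw [A.bracket_congr_right hsum, bracket_sum_smulSection, map_sum]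
  conv_rhs => rw [← b.sum_repr (secDeriv x₀ u x (A.anchor x (s x)))]
  refine Finset.sum_congr rfl fun j _ ↦ ?_
  rw [hfx, zero_smul, zero_add, map_smul, fibCoord_frameSection hx, hderiv]

/-- The structure functions `c_{αβ}^γ` of the bracket in the frame at `x₀`, as a bilinear map. -/
def structMap (x₀ x : M) : F →L[ℝ] F →L[ℝ] F :=
  LinearMap.toContinuousBilinearMap <| LinearMap.mk₂ ℝ
    (fun f g ↦ fibCoord F E x₀ x
      (A.bracket (frameSection EM E x₀ f) (frameSection EM E x₀ g) x))
    (fun f f' g ↦ by simp [map_add]) (fun c f g ↦ by simp [map_smul])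
    (fun f g g' ↦ by simp [map_add]) (fun c f g ↦ by simp [map_smul])

theorem structMap_apply (x₀ x : M) (f g : F) : A.structMap x₀ x f g =
    fibCoord F E x₀ x (A.bracket (frameSection EM E x₀ f) (frameSection EM E x₀ g) x) :=
  rfl

theorem structMap_skew (x₀ x : M) (f g : F) : A.structMap x₀ x f g = -A.structMap x₀ x g f := by
  rw [structMap_apply, structMap_apply, A.bracket_skew, ContMDiffSection.coe_neg, Pi.neg_apply,
    map_neg]

theorem fibCoord_bracket (s t : Cₛ^∞⟮𝓘(ℝ, EM); F, E⟯) (hx : x ∈ frameSet EM F E x₀) :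
    fibCoord F E x₀ x (A.bracket s t x) =
      secDeriv x₀ t x (A.anchor x (s x)) - secDeriv x₀ s x (A.anchor x (t x)) +
        A.structMap x₀ x (fibCoord F E x₀ x (s x)) (fibCoord F E x₀ x (t x)) := by
  have hb := mem_baseSet_of_mem_frameSet hx
  set s₀ := frameSection EM E x₀ (fibCoord F E x₀ x (s x)) with hs₀
  set t₀ := frameSection EM E x₀ (fibCoord F E x₀ x (t x)) with ht₀
  have hs : s₀ x = s x := fibCoord_injective hb (fibCoord_frameSection hx _)
  have ht : t₀ x = t x := fibCoord_injective hb (fibCoord_frameSection hx _)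
  have hsplit : A.bracket s t =
      A.bracket s (t - t₀) + (A.bracket s₀ t₀ - A.bracket t₀ (s - s₀)) := by
    rw [map_sub, map_sub, A.bracket_skew t₀ s, A.bracket_skew t₀ s₀]
    abel
  have ht' : fibCoord F E x₀ x (A.bracket s (t - t₀) x) = secDeriv x₀ t x (A.anchor x (s x)) := by
    rw [A.fibCoord_bracket_of_apply_eq_zero hx (by simp [ht]), secDeriv_sub hb, ht₀,
      secDeriv_frameSection hx, sub_zero]
  have hs' : fibCoord F E x₀ x (A.bracket t₀ (s - s₀) x) =
      secDeriv x₀ s x (A.anchor x (t x)) := by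
    rw [A.fibCoord_bracket_of_apply_eq_zero hx (by simp [hs]), secDeriv_sub hb, hs₀,
      secDeriv_frameSection hx, sub_zero, ht]
  have hsplit' : A.bracket s t x =
      A.bracket s (t - t₀) x + (A.bracket s₀ t₀ x - A.bracket t₀ (s - s₀) x) :=
    congrArg (fun r : Cₛ^∞⟮𝓘(ℝ, EM); F, E⟯ ↦ r x) hsplit
  rw [hsplit', map_add, ht', map_sub (fibCoord F E x₀ x), hs', structMap_apply]
  abel

end Smooth

end LocalFrames

section Prolongation

variable {EM : Type*} [NormedAddCommGroup EM] [NormedSpace ℝ EM]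
  {M : Type*} [TopologicalSpace M] [ChartedSpace EM M]
  {F : Type*} [NormedAddCommGroup F] [NormedSpace ℝ F]
  {E : M → Type*} [TopologicalSpace (TotalSpace F E)]
  [∀ x, AddCommGroup (E x)] [∀ x, Module ℝ (E x)] [∀ x, TopologicalSpace (E x)]
  [FiberBundle F E] [VectorBundle ℝ F E]
  {x₀ : M} {w₀ w : TotalSpace F E} {q : EM × F} {ρ ρ' ρ₁ ρ₂ : ProlField EM F E}
  {U : Set (TotalSpace F E)}

local notation "𝓘E" => ModelWithCorners.prod 𝓘(ℝ, EM) 𝓘(ℝ, F)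

/-- The first component of a field on `E` in the coordinates at `w₀`. -/
def fstChart (w₀ : TotalSpace F E) (ρ : ProlField EM F E) (q : EM × F) : F :=
  fibCoord F E w₀.proj _ (ρ ((extChartAt 𝓘E w₀).symm q)).1

/-- The second component of a field on `E` in the coordinates at `w₀`. -/
def sndChart (w₀ : TotalSpace F E) (ρ : ProlField EM F E) (q : EM × F) : EM × F :=
  chartVectorField (I := 𝓘E) w₀ (fun w ↦ (ρ w).2) q

variable (w₀) in
/-- The field on `E` with the coordinates `(z, X)` at `w₀`. -/
def mkField (z : EM × F → F) (X : EM × F → EM × F) : ProlField EM F E := fun w ↦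
  (fibSymm F E w₀.proj w.proj (z (extChartAt 𝓘E w₀ w)),
    (chartDeriv 𝓘E w₀ w).inverse (X (extChartAt 𝓘E w₀ w)))

theorem fstChart_mkField (z : EM × F → F) (X : EM × F → EM × F)
    (hq : q ∈ (extChartAt 𝓘E w₀).target) : fstChart w₀ (mkField w₀ z X) q = z q := by
  rw [fstChart, mkField, fibCoord_fibSymm (proj_symm_mem_baseSet hq),
    (extChartAt 𝓘E w₀).right_inv hq]

theorem fstChart_vertEndo : fstChart w₀ (vertEndo EM ρ) q = 0 := map_zero _

theorem fstChart_euler : fstChart w₀ (euler EM F E) q = 0 := map_zero _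

theorem contMDiffAt_fibSymm [ContMDiffVectorBundle ∞ F E 𝓘(ℝ, EM)] {x : M}
    (hx : x ∈ (trivializationAt F E x₀).baseSet) (f : F) :
    ContMDiffAt 𝓘(ℝ, EM) 𝓘E ∞ (fun x ↦ (⟨x, fibSymm F E x₀ x f⟩ : TotalSpace F E)) x := by
  rw [(trivializationAt F E x₀).contMDiffAt_section_iff hx]
  refine (contMDiffAt_const (c := f)).congr_of_eventuallyEq ?_
  filter_upwards [(trivializationAt F E x₀).open_baseSet.mem_nhds hx] with x' hx'
  rw [trivializationAt_apply_snd hx', fibCoord_fibSymm hx']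

theorem contMDiffAt_sectionAlong_iff [ContMDiffVectorBundle ∞ F E 𝓘(ℝ, EM)]
    {u : ∀ w : TotalSpace F E, E w.proj} (hw : w.proj ∈ (trivializationAt F E x₀).baseSet) :
    ContMDiffAt 𝓘E 𝓘E ∞ (fun w ↦ (⟨w.proj, u w⟩ : TotalSpace F E)) w ↔
      ContMDiffAt 𝓘E 𝓘(ℝ, F) ∞ (fun w ↦ fibCoord F E x₀ w.proj (u w)) w := by
  rw [(trivializationAt F E x₀).contMDiffAt_iff (by rwa [Trivialization.mem_source]),
    and_iff_right (contMDiff_proj (n := ∞) E).contMDiffAt]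
  refine Filter.EventuallyEq.contMDiffAt_iff ?_
  filter_upwards [((trivializationAt F E x₀).open_baseSet.preimage
    (FiberBundle.continuous_proj F E)).mem_nhds hw] with w hw
    using trivializationAt_apply_snd hw (u w)

section Smooth

variable [IsManifold 𝓘(ℝ, EM) ∞ M] [ContMDiffVectorBundle ∞ F E 𝓘(ℝ, EM)]

theorem sndChart_mkField (z : EM × F → F) (X : EM × F → EM × F)
    (hq : q ∈ (extChartAt 𝓘E w₀).target) : sndChart w₀ (mkField w₀ z X) q = X q := by
  have hinv := isInvertible_mfderiv_extChartAt (I := 𝓘E) ((extChartAt 𝓘E w₀).map_target hq)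
  refine (hinv.self_apply_inverse _).trans ?_
  rw [(extChartAt 𝓘E w₀).right_inv hq]

theorem prolField_ext_chart (hq : q ∈ (extChartAt 𝓘E w₀).target)
    (hfst : fstChart w₀ ρ q = fstChart w₀ ρ' q) (hsnd : sndChart w₀ ρ q = sndChart w₀ ρ' q) :
    ρ ((extChartAt 𝓘E w₀).symm q) = ρ' ((extChartAt 𝓘E w₀).symm q) :=
  Prod.ext (fibCoord_injective (proj_symm_mem_baseSet hq) hfst)
    (chartDeriv_injective ((extChartAt 𝓘E w₀).map_target hq) hsnd)

theorem sndChart_vertEndo (hq : q ∈ (extChartAt 𝓘E w₀).target) :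
    sndChart w₀ (vertEndo EM ρ) q = (0, fstChart w₀ ρ q) :=
  chartDeriv_vlift ((extChartAt 𝓘E w₀).map_target hq) _

theorem sndChart_euler (hq : q ∈ (extChartAt 𝓘E w₀).target) :
    sndChart w₀ (euler EM F E) q = (0, q.2) :=
  (chartDeriv_vlift ((extChartAt 𝓘E w₀).map_target hq) _).trans
    (by rw [fibCoord_extChartAt_symm hq])

theorem dirDeriv_symm {f : TotalSpace F E → ℝ} (hq : q ∈ (extChartAt 𝓘E w₀).target)
    (hf : DifferentiableAt ℝ (f ∘ (extChartAt 𝓘E w₀).symm) q) :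
    dirDeriv EM f ((extChartAt 𝓘E w₀).symm q) (ρ ((extChartAt 𝓘E w₀).symm q)).2 =
      fderiv ℝ (f ∘ (extChartAt 𝓘E w₀).symm) q (sndChart w₀ ρ q) :=
  mfderiv_symm_apply hq hf _

theorem contMDiffAt_fst_symm_iff (hq : q ∈ (extChartAt 𝓘E w₀).target) :
    ContMDiffAt 𝓘E 𝓘E ∞ (fun w ↦ (⟨w.proj, (ρ w).1⟩ : TotalSpace F E))
        ((extChartAt 𝓘E w₀).symm q) ↔ ContDiffAt ℝ ∞ (fstChart w₀ ρ) q :=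
  (contMDiffAt_sectionAlong_iff (proj_symm_mem_baseSet hq)).trans (contMDiffAt_symm_iff hq)

end Smooth

section Anchor

variable [IsManifold 𝓘(ℝ, EM) ∞ M] [FiniteDimensional ℝ F] (A : LieAlgebroid EM F E)

/-- The anchor in the chart and the trivialization at `x₀`. -/
def anchorCoord (x₀ : M) (y : EM) : F →L[ℝ] EM :=
  ((chartDeriv 𝓘(ℝ, EM) x₀ _).toLinearMap ∘ₗ A.anchor _ ∘ₗ
    fibSymm F E x₀ ((extChartAt 𝓘(ℝ, EM) x₀).symm y)).toContinuousLinearMap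

theorem chartDeriv_anchor (hq : q ∈ (extChartAt 𝓘E w₀).target)
    (a : E ((extChartAt 𝓘E w₀).symm q).proj) :
    chartDeriv 𝓘(ℝ, EM) w₀.proj _ (A.anchor _ a) =
      A.anchorCoord w₀.proj q.1 (fibCoord F E w₀.proj _ a) := by
  have hproj : ((extChartAt 𝓘E w₀).symm q).proj = (extChartAt 𝓘(ℝ, EM) w₀.proj).symm q.1 :=
    congrArg TotalSpace.proj (extChartAt_symm_apply hq)
  have hbase := proj_symm_mem_baseSet hq
  revert a
  rw [hproj] at hbase ⊢
  intro a
  conv_lhs => rw [← fibSymm_fibCoord hbase a]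
  rfl

variable [ContMDiffVectorBundle ∞ F E 𝓘(ℝ, EM)]

theorem contDiffAt_anchorCoord (hq : q ∈ (extChartAt 𝓘E w₀).target) :
    ContDiffAt ℝ ∞ (A.anchorCoord w₀.proj) q.1 := by
  obtain ⟨hy, hbase⟩ := mem_extChartAt_target_iff.1 hq
  refine contDiffAt_of_forall_apply fun f ↦ ?_
  exact (contMDiffAt_vectorField_symm_iff (fun x ↦ A.anchor x (fibSymm F E w₀.proj x f)) hy).1
    (A.anchor_smooth.contMDiffAt.comp _ (contMDiffAt_fibSymm hbase f))

end Anchor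

section Sections

variable [IsManifold 𝓘(ℝ, EM) ∞ M]
  [ContMDiffVectorBundle ∞ F E 𝓘(ℝ, EM)] (A : LieAlgebroid EM F E)

/-- `ρ` is a section of the prolongation at `w`, smooth at `w`. -/
structure IsSectionAt (w : TotalSpace F E) (ρ : ProlField EM F E) : Prop where
  mem : ρ w ∈ A.prolongation w
  smooth_fst : ContMDiffAt 𝓘E 𝓘E ∞ (fun w ↦ (⟨w.proj, (ρ w).1⟩ : TotalSpace F E)) w
  smooth_snd : ContMDiffAt 𝓘E (𝓘E).tangent ∞
    (fun w ↦ (⟨w, (ρ w).2⟩ : TangentBundle 𝓘E (TotalSpace F E))) w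

theorem isSectionOn_iff_forall_isSectionAt (hU : IsOpen U) :
    A.IsSectionOn U ρ ↔ ∀ w ∈ U, A.IsSectionAt w ρ :=
  ⟨fun h w hw ↦ ⟨h.mem w hw, h.smooth_fst.contMDiffAt (hU.mem_nhds hw),
    h.smooth_snd.contMDiffAt (hU.mem_nhds hw)⟩,
    fun h ↦ ⟨fun w hw ↦ (h w hw).mem, fun w hw ↦ (h w hw).smooth_fst.contMDiffWithinAt,
      fun w hw ↦ (h w hw).smooth_snd.contMDiffWithinAt⟩⟩

variable {A} in
theorem IsSectionOn.isSectionAt (hU : IsOpen U) (h : A.IsSectionOn U ρ) (hw : w ∈ U) :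
    A.IsSectionAt w ρ :=
  (A.isSectionOn_iff_forall_isSectionAt hU).1 h w hw

theorem isSectionOn_zero (U : Set (TotalSpace F E)) : A.IsSectionOn U 0 where
  mem w _ := (A.prolongation w).zero_mem
  smooth_fst := ((contMDiff_zeroSection ℝ E).comp (contMDiff_proj E)).contMDiffOn
  smooth_snd := (contMDiff_zeroSection ℝ (TangentSpace 𝓘E (M := TotalSpace F E))).contMDiffOn

variable {A} in
theorem IsSectionOn.congr (h : A.IsSectionOn U ρ) (hρ : ∀ w ∈ U, ρ' w = ρ w) :
    A.IsSectionOn U ρ' where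
  mem w hw := by rw [hρ w hw]; exact h.mem w hw
  smooth_fst := h.smooth_fst.congr fun w hw ↦
    congrArg (fun z ↦ (⟨w.proj, z.1⟩ : TotalSpace F E)) (hρ w hw)
  smooth_snd := h.smooth_snd.congr fun w hw ↦
    congrArg (fun z ↦ (⟨w, z.2⟩ : TangentBundle 𝓘E (TotalSpace F E))) (hρ w hw)

variable {A} in
theorem IsSectionAt.congr_of_eventuallyEq (h : A.IsSectionAt w ρ)
    (hρ : ∀ᶠ w' in 𝓝 w, ρ' w' = ρ w') :
    A.IsSectionAt w ρ' where
  mem := by rw [hρ.self_of_nhds]; exact h.mem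
  smooth_fst := h.smooth_fst.congr_of_eventuallyEq
    (hρ.mono fun w' hw' ↦ congrArg (fun z ↦ (⟨w'.proj, z.1⟩ : TotalSpace F E)) hw')
  smooth_snd := h.smooth_snd.congr_of_eventuallyEq (hρ.mono fun w' hw' ↦
    congrArg (fun z ↦ (⟨w', z.2⟩ : TangentBundle 𝓘E (TotalSpace F E))) hw')

variable [FiniteDimensional ℝ F]

theorem mem_prolongation_symm_iff (hq : q ∈ (extChartAt 𝓘E w₀).target) :
    ρ ((extChartAt 𝓘E w₀).symm q) ∈ A.prolongation ((extChartAt 𝓘E w₀).symm q) ↔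
      (sndChart w₀ ρ q).1 = A.anchorCoord w₀.proj q.1 (fstChart w₀ ρ q) := by
  have hsource := (extChartAt 𝓘E w₀).map_target hq
  rw [fstChart, ← A.chartDeriv_anchor hq, sndChart, chartVectorField,
    ← chartDeriv_mfderiv_proj hsource,
    (chartDeriv_injective (mem_extChartAt_source_iff.1 hsource).1).eq_iff]
  exact eq_comm

theorem isSectionAt_symm_iff (hq : q ∈ (extChartAt 𝓘E w₀).target) :
    A.IsSectionAt ((extChartAt 𝓘E w₀).symm q) ρ ↔
      (sndChart w₀ ρ q).1 = A.anchorCoord w₀.proj q.1 (fstChart w₀ ρ q) ∧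
      ContDiffAt ℝ ∞ (fstChart w₀ ρ) q ∧ ContDiffAt ℝ ∞ (sndChart w₀ ρ) q := by
  have hsnd : ContMDiffAt 𝓘E (𝓘E).tangent ∞
      (fun w ↦ (⟨w, (ρ w).2⟩ : TangentBundle 𝓘E (TotalSpace F E)))
      ((extChartAt 𝓘E w₀).symm q) ↔ ContDiffAt ℝ ∞ (sndChart w₀ ρ) q :=
    contMDiffAt_vectorField_symm_iff _ hq
  rw [← A.mem_prolongation_symm_iff hq, ← contMDiffAt_fst_symm_iff hq, ← hsnd]
  exact ⟨fun h ↦ ⟨h.mem, h.smooth_fst, h.smooth_snd⟩, fun h ↦ ⟨h.1, h.2.1, h.2.2⟩⟩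

variable [FiniteDimensional ℝ EM] [T2Space M]

theorem sndChart_prolBracket (hq : q ∈ (extChartAt 𝓘E w₀).target)
    (h₁ : DifferentiableAt ℝ (sndChart w₀ ρ₁) q) (h₂ : DifferentiableAt ℝ (sndChart w₀ ρ₂) q) :
    sndChart w₀ (A.prolBracket ρ₁ ρ₂) q =
      fderiv ℝ (sndChart w₀ ρ₂) q (sndChart w₀ ρ₁ q) -
        fderiv ℝ (sndChart w₀ ρ₁) q (sndChart w₀ ρ₂ q) :=
  chartVectorField_mlieBracket hq h₁ h₂

/-- The structure functions of the bracket in the chart and the trivialization at `x₀`. -/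
def structCoord (x₀ : M) (y : EM) : F →L[ℝ] F →L[ℝ] F :=
  A.structMap x₀ ((extChartAt 𝓘(ℝ, EM) x₀).symm y)

theorem contDiffAt_structCoord (hq : q ∈ (extChartAt 𝓘E w₀).target) :
    ContDiffAt ℝ ∞ (A.structCoord w₀.proj) q.1 := by
  obtain ⟨hy, hbase⟩ := mem_extChartAt_target_iff.1 hq
  refine contDiffAt_of_forall_apply fun f ↦ contDiffAt_of_forall_apply fun g ↦ ?_
  exact (contMDiffAt_symm_iff hy).1 (contMDiffAt_fibCoord_section _ hbase)

theorem structCoord_skew (x₀ : M) (y : EM) (f g : F) :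
    A.structCoord x₀ y f g = -A.structCoord x₀ y g f :=
  A.structMap_skew x₀ _ f g

end Sections

end Prolongation

section FirstComponent

variable {EM : Type*} [NormedAddCommGroup EM] [NormedSpace ℝ EM]
  {M : Type*} [TopologicalSpace M] [ChartedSpace EM M]
  {F : Type*} [NormedAddCommGroup F] [NormedSpace ℝ F]
  {E : M → Type*} [TopologicalSpace (TotalSpace F E)]
  [∀ x, AddCommGroup (E x)] [∀ x, Module ℝ (E x)] [∀ x, TopologicalSpace (E x)]
  [FiberBundle F E] [VectorBundle ℝ F E] [ContMDiffVectorBundle ∞ F E 𝓘(ℝ, EM)]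
  {x₀ x₁ : M} {w₀ w : TotalSpace F E} {q : EM × F} {ρ ρ₁ ρ₂ : ProlField EM F E}
  {u : ∀ w : TotalSpace F E, E w.proj}

local notation "𝓘E" => ModelWithCorners.prod 𝓘(ℝ, EM) 𝓘(ℝ, F)

theorem mfderiv_clm_apply_of_eq_zero {G H N G₁ G₂ : Type*} [NormedAddCommGroup G] [NormedSpace ℝ G]
    [TopologicalSpace H] {I : ModelWithCorners ℝ G H} [TopologicalSpace N] [ChartedSpace H N]
    [NormedAddCommGroup G₁] [NormedSpace ℝ G₁] [NormedAddCommGroup G₂] [NormedSpace ℝ G₂]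
    {T : N → G₁ →L[ℝ] G₂} {z : N → G₁} {p : N} (hT : MDifferentiableAt I 𝓘(ℝ, G₁ →L[ℝ] G₂) T p)
    (hz : MDifferentiableAt I 𝓘(ℝ, G₁) z p) (hzp : z p = 0) (v : TangentSpace I p) :
    mfderiv I 𝓘(ℝ, G₂) (fun p ↦ T p (z p)) p v = T p (mfderiv I 𝓘(ℝ, G₁) z p v) := by
  let T' : G →L[ℝ] G₁ →L[ℝ] G₂ := mfderiv I 𝓘(ℝ, G₁ →L[ℝ] G₂) T p
  let z' : G →L[ℝ] G₁ := mfderiv I 𝓘(ℝ, G₁) z p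
  have hT' : HasFDerivWithinAt (T ∘ (extChartAt I p).symm) T' (range I) (extChartAt I p p) :=
    hT.hasMFDerivAt.2
  have hz' : HasFDerivWithinAt (z ∘ (extChartAt I p).symm) z' (range I) (extChartAt I p p) :=
    hz.hasMFDerivAt.2
  have hTz : HasFDerivWithinAt ((fun p ↦ T p (z p)) ∘ (extChartAt I p).symm) ((T p).comp z')
      (range I) (extChartAt I p p) := by
    refine (hT'.clm_apply hz').congr_fderiv ?_
    rw [Function.comp_apply, Function.comp_apply, extChartAt_to_inv, hzp, map_zero, add_zero]
  have hmTz : HasMFDerivAt I 𝓘(ℝ, G₂) (fun p ↦ T p (z p)) p ((T p).comp z') :=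
    ⟨hT.continuousAt.clm_apply hz.continuousAt, hTz⟩
  exact DFunLike.congr_fun hmTz.mfderiv v

/-- The derivative at `w` of the coordinates at `x₀` of a section `u` of `E` along the projection
of `E`, for instance of the first component of a section of the prolongation. -/
def alongDeriv (x₀ : M) (u : ∀ w : TotalSpace F E, E w.proj) (w : TotalSpace F E) :
    TangentSpace 𝓘E w →L[ℝ] F :=
  mfderiv 𝓘E 𝓘(ℝ, F) (fun w ↦ fibCoord F E x₀ w.proj (u w)) w

theorem mdifferentiableAt_fibCoord_along
    (hw : w.proj ∈ (trivializationAt F E x₀).baseSet)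
    (hu : ContMDiffAt 𝓘E 𝓘E ∞ (fun w ↦ (⟨w.proj, u w⟩ : TotalSpace F E)) w) :
    MDifferentiableAt 𝓘E 𝓘(ℝ, F) (fun w ↦ fibCoord F E x₀ w.proj (u w)) w :=
  ((contMDiffAt_sectionAlong_iff hw).1 hu).mdifferentiableAt (by simp)

theorem fibCoord_alongDeriv_of_apply_eq_zero
    (hw₀ : w.proj ∈ (trivializationAt F E x₀).baseSet)
    (hw₁ : w.proj ∈ (trivializationAt F E x₁).baseSet) (huw : u w = 0)
    (hu : MDifferentiableAt 𝓘E 𝓘(ℝ, F) (fun w ↦ fibCoord F E x₀ w.proj (u w)) w)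
    (X : TangentSpace 𝓘E w) :
    fibCoord F E x₀ w.proj (fibSymm F E x₁ w.proj (alongDeriv x₁ u w X)) = alongDeriv x₀ u w X := by
  let T : TotalSpace F E → F →L[ℝ] F := fun w ↦
    (trivializationAt F E x₀).coordChangeL ℝ (trivializationAt F E x₁) w.proj
  have hT {w' : TotalSpace F E} (hw₀' : w'.proj ∈ (trivializationAt F E x₀).baseSet)
      (hw₁' : w'.proj ∈ (trivializationAt F E x₁).baseSet) (a : E w'.proj) :
      T w' (fibCoord F E x₀ w'.proj a) = fibCoord F E x₁ w'.proj a := by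
    refine (Trivialization.coordChangeL_apply _ _ ⟨hw₀', hw₁'⟩ _).trans ?_
    rw [trivializationAt_symm hw₀', trivializationAt_apply_snd hw₁', fibSymm_fibCoord hw₀']
  have hTd : MDifferentiableAt 𝓘E 𝓘(ℝ, F →L[ℝ] F) T w :=
    ((contMDiffAt_coordChangeL (n := ∞) (IB := 𝓘(ℝ, EM)) hw₀ hw₁).comp w
      (contMDiff_proj (n := ∞) E).contMDiffAt).mdifferentiableAt (by simp)
  have hTu : (fun w ↦ fibCoord F E x₁ w.proj (u w)) =ᶠ[𝓝 w]
      fun w ↦ T w (fibCoord F E x₀ w.proj (u w)) := by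
    have hnhds {x : M} (hx : w.proj ∈ (trivializationAt F E x).baseSet) :=
      ((trivializationAt F E x).open_baseSet.preimage (FiberBundle.continuous_proj F E)).mem_nhds hx
    filter_upwards [hnhds hw₀, hnhds hw₁] with w' hw₀' hw₁' using (hT hw₀' hw₁' _).symm
  have hderiv : alongDeriv x₁ u w X = T w (alongDeriv x₀ u w X) :=
    (DFunLike.congr_fun hTu.mfderiv_eq X).trans
      (mfderiv_clm_apply_of_eq_zero hTd hu (by rw [huw, map_zero]) X)
  rw [hderiv]
  conv_lhs => rw [← fibCoord_fibSymm hw₀ (alongDeriv x₀ u w X), hT hw₀ hw₁, fibSymm_fibCoord hw₁]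
  exact fibCoord_fibSymm hw₀ _

theorem hasMFDerivAt_fibCoord_sub_section (hw : w.proj ∈ (trivializationAt F E x₀).baseSet)
    (hu : ContMDiffAt 𝓘E 𝓘E ∞ (fun w ↦ (⟨w.proj, u w⟩ : TotalSpace F E)) w)
    (t : Cₛ^∞⟮𝓘(ℝ, EM); F, E⟯) :
    HasMFDerivAt 𝓘E 𝓘(ℝ, F) (fun w ↦ fibCoord F E x₀ w.proj (u w - t w.proj)) w
      (alongDeriv x₀ u w - (secDeriv x₀ t w.proj).comp
        (mfderiv 𝓘E 𝓘(ℝ, EM) (TotalSpace.proj : TotalSpace F E → M) w)) := by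
  have ht := (contMDiffAt_fibCoord_section t hw).mdifferentiableAt (by simp)
  have hproj : MDifferentiableAt 𝓘E 𝓘(ℝ, EM) (TotalSpace.proj : TotalSpace F E → M) w :=
    (contMDiff_proj (n := ∞) E).contMDiffAt.mdifferentiableAt (by simp)
  exact ((mdifferentiableAt_fibCoord_along hw hu).hasMFDerivAt.sub
    (ht.hasMFDerivAt.comp w hproj.hasMFDerivAt)).congr_of_eventuallyEq
      (.of_eq (funext fun w' ↦ map_sub (fibCoord F E x₀ w'.proj) (u w') (t w'.proj)))

theorem alongDeriv_sub_section (hw : w.proj ∈ (trivializationAt F E x₀).baseSet)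
    (hu : ContMDiffAt 𝓘E 𝓘E ∞ (fun w ↦ (⟨w.proj, u w⟩ : TotalSpace F E)) w)
    (t : Cₛ^∞⟮𝓘(ℝ, EM); F, E⟯) (X : TangentSpace 𝓘E w) :
    alongDeriv x₀ (fun w ↦ u w - t w.proj) w X = alongDeriv x₀ u w X -
      secDeriv x₀ t w.proj
        (mfderiv 𝓘E 𝓘(ℝ, EM) (TotalSpace.proj : TotalSpace F E → M) w X) :=
  DFunLike.congr_fun (hasMFDerivAt_fibCoord_sub_section hw hu t).mfderiv X

variable [IsManifold 𝓘(ℝ, EM) ∞ M] [FiniteDimensional ℝ EM] [T2Space M]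

theorem fibCoord_fstCoordDeriv (hw : w.proj ∈ (trivializationAt F E x₀).baseSet)
    (hρ : ContMDiffAt 𝓘E 𝓘E ∞ (fun w ↦ (⟨w.proj, (ρ w).1⟩ : TotalSpace F E)) w)
    (X : TangentSpace 𝓘E w) :
    fibCoord F E x₀ w.proj (fibSymm F E w.proj w.proj (fstCoordDeriv w.proj ρ w X)) =
      alongDeriv x₀ (fun w ↦ (ρ w).1) w X -
        secDeriv x₀ (constSection EM E w.proj (fstCoord w.proj ρ w)) w.proj
          (mfderiv 𝓘E 𝓘(ℝ, EM) (TotalSpace.proj : TotalSpace F E → M) w X) := by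
  set t := constSection EM E w.proj (fstCoord w.proj ρ w) with ht
  have hw₁ := mem_baseSet_trivializationAt F E w.proj
  have hfst : fstCoord w.proj ρ =ᶠ[𝓝 w] fun w' ↦ fibCoord F E w.proj w'.proj (ρ w').1 := by
    filter_upwards [((trivializationAt F E w.proj).open_baseSet.preimage
      (FiberBundle.continuous_proj F E)).mem_nhds hw₁] with w' hw' using
      trivializationAt_apply_snd hw' _
  have hzero : (ρ w).1 - t w.proj = 0 := by
    rw [ht, constSection_self, hfst.self_of_nhds, fibSymm_fibCoord hw₁, sub_self]
  have hderiv : alongDeriv w.proj (fun w ↦ (ρ w).1) w X = fstCoordDeriv w.proj ρ w X :=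
    DFunLike.congr_fun hfst.mfderiv_eq.symm X
  have h := fibCoord_alongDeriv_of_apply_eq_zero (u := fun w ↦ (ρ w).1 - t w.proj) hw hw₁ hzero
    (hasMFDerivAt_fibCoord_sub_section hw hρ t).mdifferentiableAt X
  rwa [alongDeriv_sub_section hw hρ, alongDeriv_sub_section hw₁ hρ, hderiv, ht,
    secDeriv_constSection_self, zero_apply, sub_zero] at h

variable [FiniteDimensional ℝ F]

variable (EM) in
/-- The points of `E` over the domain of the frame at `w₀`. -/
def frameDom (w₀ : TotalSpace F E) : Set (TotalSpace F E) :=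
  TotalSpace.proj ⁻¹' frameSet EM F E w₀.proj

theorem isOpen_frameDom (w₀ : TotalSpace F E) : IsOpen (frameDom EM w₀) :=
  (isOpen_frameSet w₀.proj).preimage (FiberBundle.continuous_proj F E)

theorem mem_frameDom_self (w₀ : TotalSpace F E) : w₀ ∈ frameDom EM w₀ :=
  mem_frameSet_self w₀.proj

theorem frameDom_subset_source (w₀ : TotalSpace F E) :
    frameDom EM w₀ ⊆ (extChartAt 𝓘E w₀).source := fun _ hw ↦
  mem_extChartAt_source_iff.2 ⟨mem_source_of_mem_frameSet hw, mem_baseSet_of_mem_frameSet hw⟩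

theorem exists_symm_eq_of_mem_frameDom (hw : w ∈ frameDom EM w₀) :
    ∃ q ∈ (extChartAt 𝓘E w₀).target, (extChartAt 𝓘E w₀).symm q = w :=
  have hsource := frameDom_subset_source w₀ hw
  ⟨_, (extChartAt 𝓘E w₀).map_source hsource, (extChartAt 𝓘E w₀).left_inv hsource⟩

theorem forall_mem_of_forall_symm {U : Set (TotalSpace F E)} {p : TotalSpace F E → Prop}
    (h : ∀ (w₀ : TotalSpace F E) (q : EM × F), q ∈ (extChartAt 𝓘E w₀).target →
      (extChartAt 𝓘E w₀).symm q ∈ U → (extChartAt 𝓘E w₀).symm q ∈ frameDom EM w₀ →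
      p ((extChartAt 𝓘E w₀).symm q)) :
    ∀ w ∈ U, p w := by
  intro w hw
  obtain ⟨q, hq, hqw⟩ := exists_symm_eq_of_mem_frameDom (mem_frameDom_self (EM := EM) w)
  rw [← hqw]
  exact h w q hq (by rwa [hqw]) (by rw [hqw]; exact mem_frameDom_self w)

theorem fstChart_prolBracket (A : LieAlgebroid EM F E) (hq : q ∈ (extChartAt 𝓘E w₀).target)
    (hframe : (extChartAt 𝓘E w₀).symm q ∈ frameDom EM w₀)
    (h₁ : A.IsSectionAt ((extChartAt 𝓘E w₀).symm q) ρ₁)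
    (h₂ : A.IsSectionAt ((extChartAt 𝓘E w₀).symm q) ρ₂) :
    fstChart w₀ (A.prolBracket ρ₁ ρ₂) q =
      fderiv ℝ (fstChart w₀ ρ₂) q (sndChart w₀ ρ₁ q) -
        fderiv ℝ (fstChart w₀ ρ₁) q (sndChart w₀ ρ₂ q) +
        A.structCoord w₀.proj q.1 (fstChart w₀ ρ₁ q) (fstChart w₀ ρ₂ q) := by
  have hderiv {ρ ρ' : ProlField EM F E} (h : A.IsSectionAt ((extChartAt 𝓘E w₀).symm q) ρ) :
      alongDeriv w₀.proj (fun w ↦ (ρ w).1) ((extChartAt 𝓘E w₀).symm q)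
          (ρ' ((extChartAt 𝓘E w₀).symm q)).2 =
        fderiv ℝ (fstChart w₀ ρ) q (sndChart w₀ ρ' q) :=
    mfderiv_symm_apply (f := fun w : TotalSpace F E ↦ fibCoord F E w₀.proj w.proj (ρ w).1) hq
      (((contMDiffAt_fst_symm_iff hq).1 h.smooth_fst).differentiableAt (by simp)) _
  have hstruct (f g : F) : A.structMap w₀.proj ((extChartAt 𝓘E w₀).symm q).proj f g =
      A.structCoord w₀.proj q.1 f g := by rw [structCoord, extChartAt_symm_apply hq]
  have hfst (ρ : ProlField EM F E) (w : TotalSpace F E) :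
      constSection EM E w.proj (fstCoord w.proj ρ w) w.proj = (ρ w).1 := by
    have hw := mem_baseSet_trivializationAt F E w.proj
    rw [constSection_self, fstCoord, trivializationAt_apply_snd hw, fibSymm_fibCoord hw]
  have hbase := proj_symm_mem_baseSet hq
  rw [fstChart, prolBracket, trivializationAt_symm (mem_baseSet_trivializationAt F E _), map_add,
    map_sub, map_sub, fibCoord_fstCoordDeriv hbase h₂.smooth_fst,
    fibCoord_fstCoordDeriv hbase h₁.smooth_fst, A.fibCoord_bracket _ _ hframe, hfst, hfst,
    show A.anchor _ (ρ₁ _).1 = _ from h₁.mem, show A.anchor _ (ρ₂ _).1 = _ from h₂.mem,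
    hderiv h₁, hderiv h₂, hstruct]
  simp only [fstChart]
  abel

end FirstComponent

section Lagrangian

variable {EM : Type*} [NormedAddCommGroup EM] [NormedSpace ℝ EM]
  {M : Type*} [TopologicalSpace M] [ChartedSpace EM M] [IsManifold 𝓘(ℝ, EM) ∞ M]
  {F : Type*} [NormedAddCommGroup F] [NormedSpace ℝ F]
  {E : M → Type*} [TopologicalSpace (TotalSpace F E)]
  [∀ x, AddCommGroup (E x)] [∀ x, Module ℝ (E x)] [∀ x, TopologicalSpace (E x)]
  [FiberBundle F E] [VectorBundle ℝ F E] [ContMDiffVectorBundle ∞ F E 𝓘(ℝ, EM)]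
  {w₀ w : TotalSpace F E} {q : EM × F} {ρ ρ₁ ρ₂ S : ProlField EM F E}
  {U : Set (TotalSpace F E)} {L : TotalSpace F E → ℝ}

local notation "𝓘E" => ModelWithCorners.prod 𝓘(ℝ, EM) 𝓘(ℝ, F)

/-- A function on `E` in the coordinates at `w₀`. -/
abbrev funChart (w₀ : TotalSpace F E) (f : TotalSpace F E → ℝ) : EM × F → ℝ :=
  f ∘ (extChartAt 𝓘E w₀).symm

theorem dirDeriv_vlift_symm (hq : q ∈ (extChartAt 𝓘E w₀).target)
    (hL : DifferentiableAt ℝ (funChart w₀ L) q) (a : E ((extChartAt 𝓘E w₀).symm q).proj) :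
    dirDeriv EM L ((extChartAt 𝓘E w₀).symm q) (vlift EM _ a) =
      momentum (funChart w₀ L) q (fibCoord F E w₀.proj _ a) :=
  (mfderiv_symm_apply hq hL _).trans
    (congrArg _ (chartDeriv_vlift ((extChartAt 𝓘E w₀).map_target hq) a))

theorem deriv_fibreLine (hw : w ∈ (extChartAt 𝓘E w₀).source)
    (hL : DifferentiableAt ℝ (funChart w₀ L) (extChartAt 𝓘E w₀ w)) (a : E w.proj) :
    deriv (fun t : ℝ ↦ L ⟨w.proj, w.2 + t • a⟩) 0 =
      momentum (funChart w₀ L) (extChartAt 𝓘E w₀ w) (fibCoord F E w₀.proj w.proj a) := by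
  have htarget := (extChartAt 𝓘E w₀).map_source hw
  obtain ⟨q, hq, rfl⟩ : ∃ q ∈ (extChartAt 𝓘E w₀).target, (extChartAt 𝓘E w₀).symm q = w :=
    ⟨_, htarget, (extChartAt 𝓘E w₀).left_inv hw⟩
  rw [(extChartAt 𝓘E w₀).right_inv hq] at hL ⊢
  exact (mfderiv_vlift ((mdifferentiableAt_symm_iff hq).2 hL) a).symm.trans
    (dirDeriv_vlift_symm hq hL a)

theorem fibreHess_eq_fibreHessian (hw : w ∈ (extChartAt 𝓘E w₀).source)
    (hL : ContDiffAt ℝ 2 (funChart w₀ L) (extChartAt 𝓘E w₀ w)) (a b : E w.proj) :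
    fibreHess L w a b = fibreHessian (funChart w₀ L) (extChartAt 𝓘E w₀ w)
      (fibCoord F E w₀.proj w.proj a) (fibCoord F E w₀.proj w.proj b) := by
  have hsource := mem_extChartAt_source_iff.1 hw
  have hline (s : ℝ) := extChartAt_add_smul (EM := EM) hsource.2 a s
  have hnhds : ∀ᶠ s in 𝓝 (0 : ℝ), DifferentiableAt ℝ (funChart w₀ L)
      (extChartAt 𝓘E w₀ w + s • ((0, fibCoord F E w₀.proj w.proj a) : EM × F)) := by
    have hcont : Continuous fun s : ℝ ↦
        extChartAt 𝓘E w₀ w + s • ((0, fibCoord F E w₀.proj w.proj a) : EM × F) := by fun_prop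
    have hzero : extChartAt 𝓘E w₀ w + (0 : ℝ) • ((0, fibCoord F E w₀.proj w.proj a) : EM × F) =
        extChartAt 𝓘E w₀ w := by rw [zero_smul, add_zero]
    refine hcont.continuousAt.eventually ?_
    beta_reduce
    rw [hzero]
    exact (hL.eventually (by simp)).mono fun q hq ↦ hq.differentiableAt two_ne_zero
  have hinner : (fun s : ℝ ↦ deriv (fun t : ℝ ↦ L ⟨w.proj, w.2 + s • a + t • b⟩) 0) =ᶠ[𝓝 0]
      fun s ↦ momentum (funChart w₀ L)
        (extChartAt 𝓘E w₀ w + s • ((0, fibCoord F E w₀.proj w.proj a) : EM × F))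
        (fibCoord F E w₀.proj w.proj b) := by
    filter_upwards [hnhds] with s hs
    rw [← hline] at hs ⊢
    exact deriv_fibreLine (w := ⟨w.proj, w.2 + s • a⟩)
      (mem_extChartAt_source_iff.2 hsource) hs b
  have hmomentum := (differentiableAt_momentum hL).hasFDerivAt.clm_apply
    (hasFDerivAt_const (fibCoord F E w₀.proj w.proj b) _)
  rw [fibreHess, hinner.deriv_eq]
  refine (hmomentum.hasLineDerivAt (0, fibCoord F E w₀.proj w.proj a)).deriv.trans ?_
  simp [fibreHessian]

theorem fibreHess_symm (hq : q ∈ (extChartAt 𝓘E w₀).target)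
    (hL : ContDiffAt ℝ 2 (funChart w₀ L) q) (a b : E ((extChartAt 𝓘E w₀).symm q).proj) :
    fibreHess L ((extChartAt 𝓘E w₀).symm q) a b = fibreHessian (funChart w₀ L) q
      (fibCoord F E w₀.proj _ a) (fibCoord F E w₀.proj _ b) := by
  have hright := (extChartAt 𝓘E w₀).right_inv hq
  rw [fibreHess_eq_fibreHessian ((extChartAt 𝓘E w₀).map_target hq) (by rwa [hright]), hright]

theorem IsRegularOn.fibreHessian_injective (hreg : IsRegularOn L U)
    (hq : q ∈ (extChartAt 𝓘E w₀).target) (hqU : (extChartAt 𝓘E w₀).symm q ∈ U)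
    (hL : ContDiffAt ℝ 2 (funChart w₀ L) q) :
    Function.Injective (fibreHessian (funChart w₀ L) q) := by
  rw [injective_iff_map_eq_zero]
  intro f hf
  have hbase := proj_symm_mem_baseSet hq
  have hzero := hreg _ hqU (fibSymm F E w₀.proj _ f) fun b ↦ by
    rw [fibreHess_symm hq hL, fibCoord_fibSymm hbase, hf, zero_apply]
  rw [← fibCoord_fibSymm hbase f, hzero, map_zero]

theorem cartanOne_symm (hq : q ∈ (extChartAt 𝓘E w₀).target)
    (hL : DifferentiableAt ℝ (funChart w₀ L) q) :
    cartanOne L ρ ((extChartAt 𝓘E w₀).symm q) = momentum (funChart w₀ L) q (fstChart w₀ ρ q) :=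
  dirDeriv_vlift_symm hq hL _

theorem dirDeriv_cartanOne_symm (hq : q ∈ (extChartAt 𝓘E w₀).target)
    (hL : ContDiffAt ℝ 2 (funChart w₀ L) q) (hρ₁ : DifferentiableAt ℝ (fstChart w₀ ρ₁) q) :
    dirDeriv EM (cartanOne L ρ₁) ((extChartAt 𝓘E w₀).symm q)
        (ρ₂ ((extChartAt 𝓘E w₀).symm q)).2 =
      momentum (funChart w₀ L) q (fderiv ℝ (fstChart w₀ ρ₁) q (sndChart w₀ ρ₂ q)) +
        fderiv ℝ (momentum (funChart w₀ L)) q (sndChart w₀ ρ₂ q) (fstChart w₀ ρ₁ q) := by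
  have hcoord : funChart w₀ (cartanOne L ρ₁) =ᶠ[𝓝 q]
      fun q' ↦ momentum (funChart w₀ L) q' (fstChart w₀ ρ₁ q') := by
    filter_upwards [hL.eventually (by simp), (isOpen_extChartAt_target w₀).mem_nhds hq]
      with q' hL' hq' using cartanOne_symm hq' (hL'.differentiableAt two_ne_zero)
  have hderiv := ((differentiableAt_momentum hL).hasFDerivAt.clm_apply
    hρ₁.hasFDerivAt).congr_of_eventuallyEq hcoord
  rw [dirDeriv_symm hq hderiv.differentiableAt, hderiv.fderiv]
  rfl

theorem energy_symm (hq : q ∈ (extChartAt 𝓘E w₀).target)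
    (hL : DifferentiableAt ℝ (funChart w₀ L) q) :
    energy EM L ((extChartAt 𝓘E w₀).symm q) =
      momentum (funChart w₀ L) q q.2 - funChart w₀ L q := by
  rw [energy, euler, dirDeriv_vlift_symm hq hL, fibCoord_extChartAt_symm hq]
  rfl

theorem dirDeriv_energy_symm (hq : q ∈ (extChartAt 𝓘E w₀).target)
    (hL : ContDiffAt ℝ 2 (funChart w₀ L) q) :
    dirDeriv EM (energy EM L) ((extChartAt 𝓘E w₀).symm q) (ρ ((extChartAt 𝓘E w₀).symm q)).2 =
      fderiv ℝ (momentum (funChart w₀ L)) q (sndChart w₀ ρ q) q.2 -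
        fderiv ℝ (funChart w₀ L) q ((sndChart w₀ ρ q).1, 0) := by
  have hcoord : funChart w₀ (energy EM L) =ᶠ[𝓝 q]
      fun q' ↦ momentum (funChart w₀ L) q' q'.2 - funChart w₀ L q' := by
    filter_upwards [hL.eventually (by simp), (isOpen_extChartAt_target w₀).mem_nhds hq]
      with q' hL' hq' using energy_symm hq' (hL'.differentiableAt two_ne_zero)
  have hderiv := (((differentiableAt_momentum hL).hasFDerivAt.clm_apply hasFDerivAt_snd).sub
    (hL.differentiableAt two_ne_zero).hasFDerivAt).congr_of_eventuallyEq hcoord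
  have hsplit : fderiv ℝ (funChart w₀ L) q (sndChart w₀ ρ q) =
      fderiv ℝ (funChart w₀ L) q ((sndChart w₀ ρ q).1, 0) +
        momentum (funChart w₀ L) q (sndChart w₀ ρ q).2 := by
    rw [momentum, ContinuousLinearMap.comp_apply, ContinuousLinearMap.inr_apply, ← map_add,
      Prod.fst_add_snd]
  rw [dirDeriv_symm hq hderiv.differentiableAt, hderiv.fderiv]
  simp only [add_apply, sub_apply, ContinuousLinearMap.comp_apply, ContinuousLinearMap.flip_apply,
    ContinuousLinearMap.coe_snd', hsplit]
  ring

variable [FiniteDimensional ℝ EM] [T2Space M] [FiniteDimensional ℝ F] (A : LieAlgebroid EM F E)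

theorem cartanTwo_symm (hq : q ∈ (extChartAt 𝓘E w₀).target)
    (hframe : (extChartAt 𝓘E w₀).symm q ∈ frameDom EM w₀)
    (hL : ContDiffAt ℝ 2 (funChart w₀ L) q)
    (h₁ : A.IsSectionAt ((extChartAt 𝓘E w₀).symm q) ρ₁)
    (h₂ : A.IsSectionAt ((extChartAt 𝓘E w₀).symm q) ρ₂) :
    A.cartanTwo L ρ₁ ρ₂ ((extChartAt 𝓘E w₀).symm q) =
      fderiv ℝ (momentum (funChart w₀ L)) q (sndChart w₀ ρ₁ q) (fstChart w₀ ρ₂ q) -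
        fderiv ℝ (momentum (funChart w₀ L)) q (sndChart w₀ ρ₂ q) (fstChart w₀ ρ₁ q) -
        momentum (funChart w₀ L) q
          (A.structCoord w₀.proj q.1 (fstChart w₀ ρ₁ q) (fstChart w₀ ρ₂ q)) := by
  have hfst {ρ : ProlField EM F E} (h : A.IsSectionAt ((extChartAt 𝓘E w₀).symm q) ρ) :
      DifferentiableAt ℝ (fstChart w₀ ρ) q :=
    ((A.isSectionAt_symm_iff hq).1 h).2.1.differentiableAt (by simp)
  rw [cartanTwo, dirDeriv_cartanOne_symm hq hL (hfst h₁), dirDeriv_cartanOne_symm hq hL (hfst h₂),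
    cartanOne_symm hq (hL.differentiableAt two_ne_zero), fstChart_prolBracket A hq hframe h₁ h₂,
    map_add, map_sub]
  ring

theorem cartanTwo_symm_eq_iff (hq : q ∈ (extChartAt 𝓘E w₀).target)
    (hframe : (extChartAt 𝓘E w₀).symm q ∈ frameDom EM w₀)
    (hL : ContDiffAt ℝ 2 (funChart w₀ L) q)
    (hS : A.IsSectionAt ((extChartAt 𝓘E w₀).symm q) S)
    (hρ : A.IsSectionAt ((extChartAt 𝓘E w₀).symm q) ρ) {f u : F}
    (hf : fstChart w₀ ρ q = f) (hu : (sndChart w₀ ρ q).2 = u) :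
    A.cartanTwo L S ρ ((extChartAt 𝓘E w₀).symm q) =
        -dirDeriv EM (energy EM L) ((extChartAt 𝓘E w₀).symm q)
          (ρ ((extChartAt 𝓘E w₀).symm q)).2 ↔
      fderiv ℝ (momentum (funChart w₀ L)) q
          (A.anchorCoord w₀.proj q.1 (fstChart w₀ S q), (sndChart w₀ S q).2) f -
          fderiv ℝ (momentum (funChart w₀ L)) q (A.anchorCoord w₀.proj q.1 f, u)
            (fstChart w₀ S q) -
          momentum (funChart w₀ L) q (A.structCoord w₀.proj q.1 (fstChart w₀ S q) f) =
        -(fderiv ℝ (momentum (funChart w₀ L)) q (A.anchorCoord w₀.proj q.1 f, u) q.2 -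
          fderiv ℝ (funChart w₀ L) q (A.anchorCoord w₀.proj q.1 f, 0)) := by
  rw [A.cartanTwo_symm hq hframe hL hS hρ, dirDeriv_energy_symm hq hL, ← hf, ← hu,
    ← ((A.isSectionAt_symm_iff hq).1 hS).1, ← ((A.isSectionAt_symm_iff hq).1 hρ).1]

end Lagrangian

section LagrangianSection

variable {EM : Type*} [NormedAddCommGroup EM] [NormedSpace ℝ EM]
  {M : Type*} [TopologicalSpace M] [ChartedSpace EM M] [IsManifold 𝓘(ℝ, EM) ∞ M]
  {F : Type*} [NormedAddCommGroup F] [NormedSpace ℝ F] [FiniteDimensional ℝ F]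
  {E : M → Type*} [TopologicalSpace (TotalSpace F E)]
  [∀ x, AddCommGroup (E x)] [∀ x, Module ℝ (E x)] [∀ x, TopologicalSpace (E x)]
  [FiberBundle F E] [VectorBundle ℝ F E] [ContMDiffVectorBundle ∞ F E 𝓘(ℝ, EM)]
  {w₀ w : TotalSpace F E} {q : EM × F} {S S' : ProlField EM F E}
  {U : Set (TotalSpace F E)} {L : TotalSpace F E → ℝ} (A : LieAlgebroid EM F E)

local notation "𝓘E" => ModelWithCorners.prod 𝓘(ℝ, EM) 𝓘(ℝ, F)

theorem isSectionAt_mkField_symm {z : EM × F → F} {X : EM × F → EM × F}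
    (hq : q ∈ (extChartAt 𝓘E w₀).target) (hz : ContDiffAt ℝ ∞ z q) (hX : ContDiffAt ℝ ∞ X q)
    (hanchor : (X q).1 = A.anchorCoord w₀.proj q.1 (z q)) :
    A.IsSectionAt ((extChartAt 𝓘E w₀).symm q) (mkField w₀ z X) := by
  have htarget := (isOpen_extChartAt_target w₀).mem_nhds hq
  refine (A.isSectionAt_symm_iff hq).2
    ⟨by rw [fstChart_mkField z X hq, sndChart_mkField z X hq, hanchor],
      hz.congr_of_eventuallyEq ?_, hX.congr_of_eventuallyEq ?_⟩
  · filter_upwards [htarget] with q' hq' using fstChart_mkField z X hq'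
  · filter_upwards [htarget] with q' hq' using sndChart_mkField z X hq'

/-- The section of the prolongation near `w₀` whose coordinates `f` and `u` in the fibre directions
are constant. -/
def constField (w₀ : TotalSpace F E) (f u : F) : ProlField EM F E :=
  mkField w₀ (fun _ ↦ f) (fun q ↦ (A.anchorCoord w₀.proj q.1 f, u))

theorem isSectionAt_constField_symm (hq : q ∈ (extChartAt 𝓘E w₀).target) (f u : F) :
    A.IsSectionAt ((extChartAt 𝓘E w₀).symm q) (A.constField w₀ f u) :=
  A.isSectionAt_mkField_symm hq contDiffAt_const
    ((((A.contDiffAt_anchorCoord hq).comp q contDiffAt_fst).clm_apply contDiffAt_const).prodMk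
      contDiffAt_const) rfl

variable [FiniteDimensional ℝ EM] [T2Space M]

/-- The semispray near `w₀` which solves the Euler–Lagrange equations of `L` in the coordinates at
`w₀`. -/
def lagrangianField (w₀ : TotalSpace F E) (L : TotalSpace F E → ℝ) : ProlField EM F E :=
  mkField w₀ Prod.snd fun q ↦ (A.anchorCoord w₀.proj q.1 q.2,
    lagrangeForce (A.anchorCoord w₀.proj q.1) (A.structCoord w₀.proj q.1) (funChart w₀ L) q)

theorem isSectionAt_lagrangianField_symm (hq : q ∈ (extChartAt 𝓘E w₀).target)
    (hL : ContDiffAt ℝ ∞ (funChart w₀ L) q)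
    (hreg : Function.Injective (fibreHessian (funChart w₀ L) q)) :
    A.IsSectionAt ((extChartAt 𝓘E w₀).symm q) (A.lagrangianField w₀ L) := by
  have hσ : ContDiffAt ℝ ∞ (fun q : EM × F ↦ A.anchorCoord w₀.proj q.1) q :=
    (A.contDiffAt_anchorCoord hq).comp q contDiffAt_fst
  have hc : ContDiffAt ℝ ∞ (fun q : EM × F ↦ A.structCoord w₀.proj q.1) q :=
    (A.contDiffAt_structCoord hq).comp q contDiffAt_fst
  exact A.isSectionAt_mkField_symm hq contDiffAt_snd
    ((hσ.clm_apply contDiffAt_snd).prodMk (contDiffAt_lagrangeForce hL hσ hc hreg)) rfl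

theorem eq_lagrangianField_symm_iff (hq : q ∈ (extChartAt 𝓘E w₀).target)
    (hreg : Function.Injective (fibreHessian (funChart w₀ L) q))
    (hS : A.IsSectionAt ((extChartAt 𝓘E w₀).symm q) S) :
    S ((extChartAt 𝓘E w₀).symm q) = A.lagrangianField w₀ L ((extChartAt 𝓘E w₀).symm q) ↔
      fstChart w₀ S q = q.2 ∧ EulerLagrangeAt (A.anchorCoord w₀.proj q.1)
        (A.structCoord w₀.proj q.1) (funChart w₀ L) q (sndChart w₀ S q).2 := by
  rw [eulerLagrangeAt_iff_eq_lagrangeForce hreg]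
  constructor
  · intro h
    have hfst : fstChart w₀ S q = q.2 :=
      (congrArg (fun z ↦ fibCoord F E w₀.proj _ z.1) h).trans (fstChart_mkField _ _ hq)
    have hsnd : sndChart w₀ S q = _ :=
      (congrArg (fun z ↦ chartDeriv 𝓘E w₀ _ z.2) h).trans (sndChart_mkField _ _ hq)
    exact ⟨hfst, congrArg Prod.snd hsnd⟩
  · rintro ⟨hfst, hsnd⟩
    refine prolField_ext_chart hq (hfst.trans (fstChart_mkField _ _ hq).symm)
      (Eq.trans (Prod.ext ?_ hsnd) (sndChart_mkField _ _ hq).symm)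
    rw [((A.isSectionAt_symm_iff hq).1 hS).1, hfst]

variable {A} in
theorem IsLagrangianSectionOn.eq_lagrangianField (hU : IsOpen U)
    (hL : ContMDiffOn 𝓘E 𝓘(ℝ, ℝ) ∞ L U) (hreg : IsRegularOn L U)
    (hS : A.IsLagrangianSectionOn U L S) (hw : w ∈ U) (hframe : w ∈ frameDom EM w₀) :
    S w = A.lagrangianField w₀ L w := by
  obtain ⟨q, hq, rfl⟩ := exists_symm_eq_of_mem_frameDom hframe
  have hLq := (contMDiffAt_symm_iff hq).1 (hL.contMDiffAt (hU.mem_nhds hw))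
  have hLq₂ : ContDiffAt ℝ 2 (funChart w₀ L) q := hLq.of_le ENat.LEInfty.out
  have hregq := hreg.fibreHessian_injective hq hw hLq₂
  have hSq := hS.1.isSectionAt hU hw
  have hV : IsOpen (U ∩ frameDom EM w₀) := hU.inter (isOpen_frameDom w₀)
  have htest (f u : F) : A.IsSectionOn (U ∩ frameDom EM w₀) (A.constField w₀ f u) := by
    refine (A.isSectionOn_iff_forall_isSectionAt hV).2 fun w hw ↦ ?_
    obtain ⟨q, hq, rfl⟩ := exists_symm_eq_of_mem_frameDom hw.2
    exact A.isSectionAt_constField_symm hq f u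
  rw [A.eq_lagrangianField_symm_iff hq hregq hSq,
    ← forall_cartan_eq_iff_eulerLagrangeAt hLq₂ hregq]
  intro f u
  exact (A.cartanTwo_symm_eq_iff hq hframe hLq₂ hSq (A.isSectionAt_constField_symm hq f u)
    (fstChart_mkField _ _ hq) (congrArg Prod.snd (sndChart_mkField _ _ hq))).1
    (hS.2 _ inter_subset_left hV _ (htest f u) _ ⟨hw, hframe⟩)

theorem isLagrangianSectionOn_of_eq_lagrangianField (hU : IsOpen U)
    (hL : ContMDiffOn 𝓘E 𝓘(ℝ, ℝ) ∞ L U) (hreg : IsRegularOn L U) (hS : A.IsSectionOn U S)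
    (h : ∀ w ∈ U, ∃ w₀, w ∈ frameDom EM w₀ ∧ S w = A.lagrangianField w₀ L w) :
    A.IsLagrangianSectionOn U L S := by
  refine ⟨hS, fun V hVU hV ρ hρ w hwV ↦ ?_⟩
  have hw := hVU hwV
  obtain ⟨w₀, hframe, hSw⟩ := h w hw
  obtain ⟨q, hq, rfl⟩ := exists_symm_eq_of_mem_frameDom hframe
  have hLq := (contMDiffAt_symm_iff hq).1 (hL.contMDiffAt (hU.mem_nhds hw))
  have hLq₂ : ContDiffAt ℝ 2 (funChart w₀ L) q := hLq.of_le ENat.LEInfty.out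
  have hregq := hreg.fibreHessian_injective hq hw hLq₂
  have hSq := hS.isSectionAt hU hw
  have hρq := hρ.isSectionAt hV hwV
  rw [A.eq_lagrangianField_symm_iff hq hregq hSq,
    ← forall_cartan_eq_iff_eulerLagrangeAt hLq₂ hregq] at hSw
  exact (A.cartanTwo_symm_eq_iff hq hframe hLq₂ hSq hρq rfl rfl).2 (hSw _ _)

theorem isSectionAt_lagrangianField (hU : IsOpen U) (hL : ContMDiffOn 𝓘E 𝓘(ℝ, ℝ) ∞ L U)
    (hreg : IsRegularOn L U) (hw : w ∈ U) (hframe : w ∈ frameDom EM w₀) :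
    A.IsSectionAt w (A.lagrangianField w₀ L) := by
  obtain ⟨q, hq, rfl⟩ := exists_symm_eq_of_mem_frameDom hframe
  have hLq := (contMDiffAt_symm_iff hq).1 (hL.contMDiffAt (hU.mem_nhds hw))
  exact A.isSectionAt_lagrangianField_symm hq hLq
    (hreg.fibreHessian_injective hq hw (hLq.of_le ENat.LEInfty.out))

theorem lagrangianField_eq_lagrangianField_self (hU : IsOpen U)
    (hL : ContMDiffOn 𝓘E 𝓘(ℝ, ℝ) ∞ L U) (hreg : IsRegularOn L U) (hw : w ∈ U)
    (hframe : w ∈ frameDom EM w₀) : A.lagrangianField w₀ L w = A.lagrangianField w L w := by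
  have hV : IsOpen (U ∩ frameDom EM w₀) := hU.inter (isOpen_frameDom w₀)
  have hLV := hL.mono (inter_subset_left (t := frameDom EM w₀))
  have hregV : IsRegularOn L (U ∩ frameDom EM w₀) := fun w hw ↦ hreg w hw.1
  exact (A.isLagrangianSectionOn_of_eq_lagrangianField hV hLV hregV
    ((A.isSectionOn_iff_forall_isSectionAt hV).2 fun w hw ↦
      A.isSectionAt_lagrangianField hU hL hreg hw.1 hw.2)
    fun w hw ↦ ⟨w₀, hw.2, rfl⟩).eq_lagrangianField hV hLV hregV ⟨hw, hframe⟩ (mem_frameDom_self w)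

theorem exists_isLagrangianSectionOn (hU : IsOpen U) (hL : ContMDiffOn 𝓘E 𝓘(ℝ, ℝ) ∞ L U)
    (hreg : IsRegularOn L U) : ∃ S, A.IsLagrangianSectionOn U L S := by
  refine ⟨fun w ↦ A.lagrangianField w L w,
    A.isLagrangianSectionOn_of_eq_lagrangianField hU hL hreg ?_
      fun w _ ↦ ⟨w, mem_frameDom_self w, rfl⟩⟩
  refine (A.isSectionOn_iff_forall_isSectionAt hU).2 fun w hw ↦ ?_
  have hsection := A.isSectionAt_lagrangianField hU hL hreg hw (mem_frameDom_self w)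
  refine hsection.congr_of_eventuallyEq ?_
  filter_upwards [hU.mem_nhds hw, (isOpen_frameDom (EM := EM) w).mem_nhds (mem_frameDom_self w)]
    with w' hw' hframe
  exact (A.lagrangianField_eq_lagrangianField_self hU hL hreg hw' hframe).symm

namespace IsLagrangianSectionOn

variable {A}

theorem eqOn (hU : IsOpen U) (hL : ContMDiffOn 𝓘E 𝓘(ℝ, ℝ) ∞ L U) (hreg : IsRegularOn L U)
    (hS : A.IsLagrangianSectionOn U L S) (hS' : A.IsLagrangianSectionOn U L S') :
    ∀ w ∈ U, S' w = S w := fun w hw ↦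
  (hS'.eq_lagrangianField hU hL hreg hw (mem_frameDom_self w)).trans
    (hS.eq_lagrangianField hU hL hreg hw (mem_frameDom_self w)).symm

theorem fstChart_eq_and_eulerLagrangeAt (hU : IsOpen U) (hL : ContMDiffOn 𝓘E 𝓘(ℝ, ℝ) ∞ L U)
    (hreg : IsRegularOn L U) (hS : A.IsLagrangianSectionOn U L S)
    (hq : q ∈ (extChartAt 𝓘E w₀).target) (hqU : (extChartAt 𝓘E w₀).symm q ∈ U)
    (hframe : (extChartAt 𝓘E w₀).symm q ∈ frameDom EM w₀) :
    fstChart w₀ S q = q.2 ∧ EulerLagrangeAt (A.anchorCoord w₀.proj q.1)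
      (A.structCoord w₀.proj q.1) (funChart w₀ L) q (sndChart w₀ S q).2 := by
  have hLq := (contMDiffAt_symm_iff hq).1 (hL.contMDiffAt (hU.mem_nhds hqU))
  exact (A.eq_lagrangianField_symm_iff hq
    (hreg.fibreHessian_injective hq hqU (hLq.of_le ENat.LEInfty.out))
    (hS.1.isSectionAt hU hqU)).1
    (hS.eq_lagrangianField hU hL hreg hqU hframe)

theorem isSemisprayOn (hU : IsOpen U) (hL : ContMDiffOn 𝓘E 𝓘(ℝ, ℝ) ∞ L U)
    (hreg : IsRegularOn L U) (hS : A.IsLagrangianSectionOn U L S) : A.IsSemisprayOn U S := by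
  refine ⟨hS.1, forall_mem_of_forall_symm (EM := EM) fun w₀ q hq hqU hframe ↦ ?_⟩
  have hfst := (hS.fstChart_eq_and_eulerLagrangeAt hU hL hreg hq hqU hframe).1
  exact prolField_ext_chart hq (fstChart_vertEndo.trans fstChart_euler.symm)
    ((sndChart_vertEndo hq).trans ((congrArg _ hfst).trans (sndChart_euler hq).symm))

end IsLagrangianSectionOn

end LagrangianSection

section Connection

variable {EM : Type*} [NormedAddCommGroup EM] [NormedSpace ℝ EM]
  {M : Type*} [TopologicalSpace M] [ChartedSpace EM M]
  {F : Type*} [NormedAddCommGroup F] [NormedSpace ℝ F]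
  {E : M → Type*} [TopologicalSpace (TotalSpace F E)]
  [∀ x, AddCommGroup (E x)] [∀ x, TopologicalSpace (E x)]
  [FiberBundle F E]
  {w₀ : TotalSpace F E} {q : EM × F} {ρ ρ₁ ρ₂ S : ProlField EM F E}
  {U : Set (TotalSpace F E)}

local notation "𝓘E" => ModelWithCorners.prod 𝓘(ℝ, EM) 𝓘(ℝ, F)

theorem sndChart_add :
    sndChart w₀ (fun w ↦ ρ₁ w + ρ₂ w) q = sndChart w₀ ρ₁ q + sndChart w₀ ρ₂ q :=
  map_add (chartDeriv 𝓘E w₀ _) _ _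

theorem sndChart_neg : sndChart w₀ (fun w ↦ -ρ w) q = -sndChart w₀ ρ q :=
  map_neg (chartDeriv 𝓘E w₀ _) _

/-- The component in the fibre directions of the second component of a field on `E`, in the
coordinates at `w₀`. -/
def vertChart (w₀ : TotalSpace F E) (ρ : ProlField EM F E) (q : EM × F) : F :=
  (sndChart w₀ ρ q).2

theorem vertChart_add :
    vertChart w₀ (fun w ↦ ρ₁ w + ρ₂ w) q = vertChart w₀ ρ₁ q + vertChart w₀ ρ₂ q :=
  congrArg Prod.snd sndChart_add

variable [∀ x, Module ℝ (E x)]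

theorem sndChart_smul (f : TotalSpace F E → ℝ) :
    sndChart w₀ (fun w ↦ f w • ρ w) q = funChart w₀ f q • sndChart w₀ ρ q :=
  map_smul (chartDeriv 𝓘E w₀ _) _ _

theorem vertChart_smul (f : TotalSpace F E → ℝ) :
    vertChart w₀ (fun w ↦ f w • ρ w) q = funChart w₀ f q • vertChart w₀ ρ q :=
  congrArg Prod.snd (sndChart_smul f)

variable [VectorBundle ℝ F E]

theorem fstChart_add :
    fstChart w₀ (fun w ↦ ρ₁ w + ρ₂ w) q = fstChart w₀ ρ₁ q + fstChart w₀ ρ₂ q :=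
  map_add (fibCoord F E w₀.proj _) _ _

theorem fstChart_neg : fstChart w₀ (fun w ↦ -ρ w) q = -fstChart w₀ ρ q :=
  map_neg (fibCoord F E w₀.proj _) _

theorem fstChart_smul (f : TotalSpace F E → ℝ) :
    fstChart w₀ (fun w ↦ f w • ρ w) q = funChart w₀ f q • fstChart w₀ ρ q :=
  map_smul (fibCoord F E w₀.proj _) _ _

theorem fstChart_eq_zero_iff (hq : q ∈ (extChartAt 𝓘E w₀).target) :
    fstChart w₀ ρ q = 0 ↔ (ρ ((extChartAt 𝓘E w₀).symm q)).1 = 0 :=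
  map_eq_zero_iff (fibCoord F E w₀.proj _) (fibCoord_injective (proj_symm_mem_baseSet hq))

variable [IsManifold 𝓘(ℝ, EM) ∞ M] [ContMDiffVectorBundle ∞ F E 𝓘(ℝ, EM)]

variable {A : LieAlgebroid EM F E}

theorem IsSemisprayOn.fstChart_eq (hS : A.IsSemisprayOn U S) (hq : q ∈ (extChartAt 𝓘E w₀).target)
    (hqU : (extChartAt 𝓘E w₀).symm q ∈ U) : fstChart w₀ S q = q.2 := by
  have h : sndChart w₀ (vertEndo EM S) q = sndChart w₀ (euler EM F E) q :=
    congrArg (fun z ↦ chartDeriv 𝓘E w₀ _ z.2) (hS.2 _ hqU)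
  rw [sndChart_vertEndo hq, sndChart_euler hq] at h
  exact congrArg Prod.snd h

theorem IsSemisprayOn.hasFDerivAt_fstChart (hU : IsOpen U) (hS : A.IsSemisprayOn U S)
    (hq : q ∈ (extChartAt 𝓘E w₀).target) (hqU : (extChartAt 𝓘E w₀).symm q ∈ U) :
    HasFDerivAt (fstChart w₀ S) (.snd ℝ EM F) q := by
  refine hasFDerivAt_snd.congr_of_eventuallyEq ?_
  filter_upwards [eventually_extChartAt_symm_mem hU hq hqU] with q' hq'
  exact hS.fstChart_eq hq'.1 hq'.2

variable [FiniteDimensional ℝ F]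

namespace IsSectionAt

theorem contDiffAt_fstChart (hq : q ∈ (extChartAt 𝓘E w₀).target)
    (h : A.IsSectionAt ((extChartAt 𝓘E w₀).symm q) ρ) :
    ContDiffAt ℝ ∞ (fstChart w₀ ρ) q :=
  ((A.isSectionAt_symm_iff hq).1 h).2.1

theorem contDiffAt_vertChart (hq : q ∈ (extChartAt 𝓘E w₀).target)
    (h : A.IsSectionAt ((extChartAt 𝓘E w₀).symm q) ρ) :
    ContDiffAt ℝ ∞ (vertChart w₀ ρ) q :=
  ((A.isSectionAt_symm_iff hq).1 h).2.2.snd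

theorem sndChart_eq (hq : q ∈ (extChartAt 𝓘E w₀).target)
    (h : A.IsSectionAt ((extChartAt 𝓘E w₀).symm q) ρ) :
    sndChart w₀ ρ q = (A.anchorCoord w₀.proj q.1 (fstChart w₀ ρ q), vertChart w₀ ρ q) :=
  Prod.ext ((A.isSectionAt_symm_iff hq).1 h).1 rfl

theorem add_symm (hq : q ∈ (extChartAt 𝓘E w₀).target)
    (h₁ : A.IsSectionAt ((extChartAt 𝓘E w₀).symm q) ρ₁)
    (h₂ : A.IsSectionAt ((extChartAt 𝓘E w₀).symm q) ρ₂) :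
    A.IsSectionAt ((extChartAt 𝓘E w₀).symm q) fun w ↦ ρ₁ w + ρ₂ w := by
  rw [isSectionAt_symm_iff A hq] at h₁ h₂ ⊢
  refine ⟨by rw [fstChart_add, sndChart_add, Prod.fst_add, map_add, h₁.1, h₂.1], ?_, ?_⟩
  · exact (h₁.2.1.add h₂.2.1).congr_of_eventuallyEq (.of_eq (funext fun _ ↦ fstChart_add))
  · exact (h₁.2.2.add h₂.2.2).congr_of_eventuallyEq (.of_eq (funext fun _ ↦ sndChart_add))

theorem smul_symm {f : TotalSpace F E → ℝ} (hq : q ∈ (extChartAt 𝓘E w₀).target)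
    (hf : ContMDiffAt 𝓘E 𝓘(ℝ, ℝ) ∞ f ((extChartAt 𝓘E w₀).symm q))
    (h : A.IsSectionAt ((extChartAt 𝓘E w₀).symm q) ρ) :
    A.IsSectionAt ((extChartAt 𝓘E w₀).symm q) fun w ↦ f w • ρ w := by
  rw [isSectionAt_symm_iff A hq] at h ⊢
  rw [contMDiffAt_symm_iff hq] at hf
  refine ⟨by rw [fstChart_smul, sndChart_smul, Prod.smul_fst, map_smul, h.1], ?_, ?_⟩
  · exact (hf.smul h.2.1).congr_of_eventuallyEq (.of_eq (funext fun _ ↦ fstChart_smul f))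
  · exact (hf.smul h.2.2).congr_of_eventuallyEq (.of_eq (funext fun _ ↦ sndChart_smul f))

end IsSectionAt

theorem isSectionAt_vertEndo_symm (hq : q ∈ (extChartAt 𝓘E w₀).target)
    (h : A.IsSectionAt ((extChartAt 𝓘E w₀).symm q) ρ) :
    A.IsSectionAt ((extChartAt 𝓘E w₀).symm q) (vertEndo EM ρ) := by
  refine (A.isSectionAt_symm_iff hq).2
    ⟨by rw [fstChart_vertEndo, sndChart_vertEndo hq, map_zero], ?_, ?_⟩
  · exact contDiffAt_const.congr_of_eventuallyEq (.of_eq (funext fun _ ↦ fstChart_vertEndo))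
  · refine ((contDiffAt_const (c := (0 : EM))).prodMk
      (h.contDiffAt_fstChart hq)).congr_of_eventuallyEq ?_
    filter_upwards [(isOpen_extChartAt_target w₀).mem_nhds hq] with q' hq'
    exact sndChart_vertEndo hq'

theorem IsSemisprayOn.differentiableAt_vertChart (hU : IsOpen U) (hS : A.IsSemisprayOn U S)
    (hq : q ∈ (extChartAt 𝓘E w₀).target) (hqU : (extChartAt 𝓘E w₀).symm q ∈ U) :
    DifferentiableAt ℝ (vertChart w₀ S) q :=
  ((hS.1.isSectionAt hU hqU).contDiffAt_vertChart hq).differentiableAt (by simp)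

theorem IsSemisprayOn.sndChart_eq (hU : IsOpen U) (hS : A.IsSemisprayOn U S)
    (hq : q ∈ (extChartAt 𝓘E w₀).target) (hqU : (extChartAt 𝓘E w₀).symm q ∈ U) :
    sndChart w₀ S q = (A.anchorCoord w₀.proj q.1 q.2, vertChart w₀ S q) := by
  rw [(hS.1.isSectionAt hU hqU).sndChart_eq hq, hS.fstChart_eq hq hqU]

theorem IsSemisprayOn.fderiv_sndChart_inr (hU : IsOpen U) (hS : A.IsSemisprayOn U S)
    (hq : q ∈ (extChartAt 𝓘E w₀).target) (hqU : (extChartAt 𝓘E w₀).symm q ∈ U) (f : F) :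
    fderiv ℝ (sndChart w₀ S) q (0, f) =
      (A.anchorCoord w₀.proj q.1 f, fderiv ℝ (vertChart w₀ S) q (0, f)) := by
  have hσ := ((A.contDiffAt_anchorCoord hq).differentiableAt (by simp)).hasFDerivAt.comp q
    (hasFDerivAt_fst (𝕜 := ℝ) (E := EM) (F := F))
  have hcoord : sndChart w₀ S =ᶠ[𝓝 q]
      fun q' ↦ (A.anchorCoord w₀.proj q'.1 q'.2, vertChart w₀ S q') := by
    filter_upwards [eventually_extChartAt_symm_mem hU hq hqU] with q' hq'
    exact hS.sndChart_eq hU hq'.1 hq'.2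
  rw [(((hσ.clm_apply hasFDerivAt_snd).prodMk
    (hS.differentiableAt_vertChart hU hq hqU).hasFDerivAt).congr_of_eventuallyEq hcoord).fderiv]
  simp

variable [FiniteDimensional ℝ EM] [T2Space M]

variable (A) in
/-- The linear part of `v ↦ P(f, v)` in coordinates, where `P = -ℒ_S J` is the connection of a
semispray `S`: in the coordinates at `w₀` one has `P(f, v) = (f, connCoord f - v)`. -/
def connCoord (w₀ : TotalSpace F E) (S : ProlField EM F E) (q : EM × F) : F →L[ℝ] F :=
  (fderiv ℝ (vertChart w₀ S) q).comp (.inr ℝ EM F) + A.structCoord w₀.proj q.1 q.2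

theorem IsSectionAt.contDiffAt_connCoord (hq : q ∈ (extChartAt 𝓘E w₀).target)
    (hS : A.IsSectionAt ((extChartAt 𝓘E w₀).symm q) S) :
    ContDiffAt ℝ ∞ (A.connCoord w₀ S) q :=
  (((hS.contDiffAt_vertChart hq).fderiv_right (by simp)).clm_comp contDiffAt_const).add
    (((A.contDiffAt_structCoord hq).comp q contDiffAt_fst).clm_apply contDiffAt_snd)

namespace IsSemisprayOn

theorem fstChart_prolBracket (hU : IsOpen U) (hS : A.IsSemisprayOn U S)
    (hq : q ∈ (extChartAt 𝓘E w₀).target) (hqU : (extChartAt 𝓘E w₀).symm q ∈ U)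
    (hframe : (extChartAt 𝓘E w₀).symm q ∈ frameDom EM w₀)
    (hρ : A.IsSectionAt ((extChartAt 𝓘E w₀).symm q) ρ) :
    fstChart w₀ (A.prolBracket S ρ) q = fderiv ℝ (fstChart w₀ ρ) q (sndChart w₀ S q) -
      vertChart w₀ ρ q + A.structCoord w₀.proj q.1 q.2 (fstChart w₀ ρ q) := by
  rw [LieAlgebroid.fstChart_prolBracket A hq hframe (hS.1.isSectionAt hU hqU) hρ,
    (hS.hasFDerivAt_fstChart hU hq hqU).fderiv, hS.fstChart_eq hq hqU]
  rfl

theorem sndChart_prolBracket_of_sndChart_eq {v : EM × F → F} {v' : EM × F →L[ℝ] F}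
    (hU : IsOpen U) (hS : A.IsSemisprayOn U S)
    (hq : q ∈ (extChartAt 𝓘E w₀).target) (hqU : (extChartAt 𝓘E w₀).symm q ∈ U)
    (hv : HasFDerivAt v v' q) (hρ : ∀ᶠ q' in 𝓝 q, sndChart w₀ ρ q' = (0, v q')) :
    sndChart w₀ (A.prolBracket S ρ) q = (-A.anchorCoord w₀.proj q.1 (v q),
      v' (sndChart w₀ S q) - fderiv ℝ (vertChart w₀ S) q (0, v q)) := by
  have hderiv := ((hasFDerivAt_const (0 : EM) q).prodMk hv).congr_of_eventuallyEq hρ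
  have hdiff : DifferentiableAt ℝ (sndChart w₀ S) q :=
    ((A.isSectionAt_symm_iff hq).1 (hS.1.isSectionAt hU hqU)).2.2.differentiableAt (by simp)
  rw [A.sndChart_prolBracket hq hdiff hderiv.differentiableAt, hderiv.fderiv, hρ.self_of_nhds,
    hS.fderiv_sndChart_inr hU hq hqU]
  simp

theorem fstChart_conn (hU : IsOpen U) (hS : A.IsSemisprayOn U S)
    (hq : q ∈ (extChartAt 𝓘E w₀).target) (hqU : (extChartAt 𝓘E w₀).symm q ∈ U)
    (hframe : (extChartAt 𝓘E w₀).symm q ∈ frameDom EM w₀)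
    (hρ : A.IsSectionAt ((extChartAt 𝓘E w₀).symm q) ρ) :
    fstChart w₀ (A.conn S ρ) q = fstChart w₀ ρ q := by
  have hsum : fstChart w₀ (A.conn S ρ) q = -fstChart w₀ (A.prolBracket S (vertEndo EM ρ)) q +
      fstChart w₀ (vertEndo EM (A.prolBracket S ρ)) q := by
    rw [← fstChart_neg, ← fstChart_add]
    rfl
  have hzero : fstChart w₀ (vertEndo EM ρ) = fun _ ↦ 0 := funext fun _ ↦ fstChart_vertEndo
  rw [hsum, hS.fstChart_prolBracket hU hq hqU hframe (isSectionAt_vertEndo_symm hq hρ),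
    fstChart_vertEndo, fstChart_vertEndo, vertChart, sndChart_vertEndo hq, hzero]
  simp

theorem sndChart_conn (hU : IsOpen U) (hS : A.IsSemisprayOn U S)
    (hq : q ∈ (extChartAt 𝓘E w₀).target) (hqU : (extChartAt 𝓘E w₀).symm q ∈ U)
    (hframe : (extChartAt 𝓘E w₀).symm q ∈ frameDom EM w₀)
    (hρ : A.IsSectionAt ((extChartAt 𝓘E w₀).symm q) ρ) :
    sndChart w₀ (A.conn S ρ) q = (A.anchorCoord w₀.proj q.1 (fstChart w₀ ρ q),
      A.connCoord w₀ S q (fstChart w₀ ρ q) - vertChart w₀ ρ q) := by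
  have hsum : sndChart w₀ (A.conn S ρ) q = -sndChart w₀ (A.prolBracket S (vertEndo EM ρ)) q +
      sndChart w₀ (vertEndo EM (A.prolBracket S ρ)) q := by
    rw [← sndChart_neg, ← sndChart_add]
    rfl
  have hJρ : ∀ᶠ q' in 𝓝 q, sndChart w₀ (vertEndo EM ρ) q' = (0, fstChart w₀ ρ q') := by
    filter_upwards [(isOpen_extChartAt_target w₀).mem_nhds hq] with q' hq'
    exact sndChart_vertEndo hq'
  rw [hsum, hS.sndChart_prolBracket_of_sndChart_eq hU hq hqU
    ((hρ.contDiffAt_fstChart hq).differentiableAt (by simp)).hasFDerivAt hJρ, sndChart_vertEndo hq,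
    hS.fstChart_prolBracket hU hq hqU hframe hρ, connCoord]
  ext
  · simp
  · simp only [Prod.snd_add, Prod.snd_neg, add_apply, ContinuousLinearMap.comp_apply,
      ContinuousLinearMap.inr_apply]
    abel

theorem vertChart_conn (hU : IsOpen U) (hS : A.IsSemisprayOn U S)
    (hq : q ∈ (extChartAt 𝓘E w₀).target) (hqU : (extChartAt 𝓘E w₀).symm q ∈ U)
    (hframe : (extChartAt 𝓘E w₀).symm q ∈ frameDom EM w₀)
    (hρ : A.IsSectionAt ((extChartAt 𝓘E w₀).symm q) ρ) :
    vertChart w₀ (A.conn S ρ) q =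
      A.connCoord w₀ S q (fstChart w₀ ρ q) - vertChart w₀ ρ q :=
  congrArg Prod.snd (hS.sndChart_conn hU hq hqU hframe hρ)

theorem isSectionOn_conn (hU : IsOpen U) (hS : A.IsSemisprayOn U S) (hρ : A.IsSectionOn U ρ) :
    A.IsSectionOn U (A.conn S ρ) := by
  refine (A.isSectionOn_iff_forall_isSectionAt hU).2 <|
    forall_mem_of_forall_symm (EM := EM) fun w₀ q hq hqU hframe ↦ ?_
  have hρq := hρ.isSectionAt hU hqU
  have hnear := eventually_extChartAt_symm_mem (hU.inter (isOpen_frameDom (EM := EM) w₀)) hq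
    ⟨hqU, hframe⟩
  refine (A.isSectionAt_symm_iff hq).2 ⟨?_, ?_, ?_⟩
  · rw [hS.sndChart_conn hU hq hqU hframe hρq, hS.fstChart_conn hU hq hqU hframe hρq]
  · refine (hρq.contDiffAt_fstChart hq).congr_of_eventuallyEq ?_
    filter_upwards [hnear] with q' ⟨hq', hqU', hframe'⟩
    exact hS.fstChart_conn hU hq' hqU' hframe' (hρ.isSectionAt hU hqU')
  · have hσ := ((A.contDiffAt_anchorCoord hq).comp q contDiffAt_fst).clm_apply
      (hρq.contDiffAt_fstChart hq)
    have hP := ((hS.1.isSectionAt hU hqU).contDiffAt_connCoord hq).clm_apply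
      (hρq.contDiffAt_fstChart hq)
    refine (hσ.prodMk (hP.sub (hρq.contDiffAt_vertChart hq))).congr_of_eventuallyEq ?_
    filter_upwards [hnear] with q' ⟨hq', hqU', hframe'⟩
    exact hS.sndChart_conn hU hq' hqU' hframe' (hρ.isSectionAt hU hqU')

theorem conn_add_symm (hU : IsOpen U) (hS : A.IsSemisprayOn U S)
    (hq : q ∈ (extChartAt 𝓘E w₀).target) (hqU : (extChartAt 𝓘E w₀).symm q ∈ U)
    (hframe : (extChartAt 𝓘E w₀).symm q ∈ frameDom EM w₀)
    (h₁ : A.IsSectionAt ((extChartAt 𝓘E w₀).symm q) ρ₁)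
    (h₂ : A.IsSectionAt ((extChartAt 𝓘E w₀).symm q) ρ₂) :
    A.conn S (fun w ↦ ρ₁ w + ρ₂ w) ((extChartAt 𝓘E w₀).symm q) =
      A.conn S ρ₁ ((extChartAt 𝓘E w₀).symm q) + A.conn S ρ₂ ((extChartAt 𝓘E w₀).symm q) := by
  have hadd := h₁.add_symm hq h₂
  refine prolField_ext_chart (ρ' := fun w ↦ A.conn S ρ₁ w + A.conn S ρ₂ w) hq ?_ ?_
  · rw [hS.fstChart_conn hU hq hqU hframe hadd, fstChart_add, fstChart_add,
      hS.fstChart_conn hU hq hqU hframe h₁, hS.fstChart_conn hU hq hqU hframe h₂]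
  · rw [hS.sndChart_conn hU hq hqU hframe hadd, fstChart_add, vertChart_add, sndChart_add,
      hS.sndChart_conn hU hq hqU hframe h₁, hS.sndChart_conn hU hq hqU hframe h₂, map_add, map_add,
      Prod.mk_add_mk, add_sub_add_comm]

theorem conn_smul_symm (hU : IsOpen U) (hS : A.IsSemisprayOn U S) {f : TotalSpace F E → ℝ}
    (hq : q ∈ (extChartAt 𝓘E w₀).target) (hqU : (extChartAt 𝓘E w₀).symm q ∈ U)
    (hframe : (extChartAt 𝓘E w₀).symm q ∈ frameDom EM w₀)
    (hf : ContMDiffAt 𝓘E 𝓘(ℝ, ℝ) ∞ f ((extChartAt 𝓘E w₀).symm q))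
    (hρ : A.IsSectionAt ((extChartAt 𝓘E w₀).symm q) ρ) :
    A.conn S (fun w ↦ f w • ρ w) ((extChartAt 𝓘E w₀).symm q) =
      f ((extChartAt 𝓘E w₀).symm q) • A.conn S ρ ((extChartAt 𝓘E w₀).symm q) := by
  have hsmul := hρ.smul_symm hq hf
  refine prolField_ext_chart (ρ' := fun w ↦ f w • A.conn S ρ w) hq ?_ ?_
  · rw [hS.fstChart_conn hU hq hqU hframe hsmul, fstChart_smul, fstChart_smul,
      hS.fstChart_conn hU hq hqU hframe hρ]
  · rw [hS.sndChart_conn hU hq hqU hframe hsmul, fstChart_smul, vertChart_smul, sndChart_smul,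
      hS.sndChart_conn hU hq hqU hframe hρ, map_smul, map_smul, Prod.smul_mk, smul_sub]

theorem conn_conn (hU : IsOpen U) (hS : A.IsSemisprayOn U S) (hρ : A.IsSectionOn U ρ) :
    ∀ w ∈ U, A.conn S (A.conn S ρ) w = ρ w := by
  refine forall_mem_of_forall_symm (EM := EM) fun w₀ q hq hqU hframe ↦ ?_
  have hρq := hρ.isSectionAt hU hqU
  have hconn := (hS.isSectionOn_conn hU hρ).isSectionAt hU hqU
  refine prolField_ext_chart hq ?_ ?_
  · rw [hS.fstChart_conn hU hq hqU hframe hconn, hS.fstChart_conn hU hq hqU hframe hρq]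
  · rw [hS.sndChart_conn hU hq hqU hframe hconn, hS.fstChart_conn hU hq hqU hframe hρq,
      hS.vertChart_conn hU hq hqU hframe hρq, sub_sub_cancel, hρq.sndChart_eq hq]

theorem conn_eq_neg_iff (hU : IsOpen U) (hS : A.IsSemisprayOn U S) (hρ : A.IsSectionOn U ρ) :
    ∀ w ∈ U, A.conn S ρ w = -ρ w ↔ (ρ w).1 = 0 := by
  refine forall_mem_of_forall_symm (EM := EM) fun w₀ q hq hqU hframe ↦ ?_
  have hρq := hρ.isSectionAt hU hqU
  rw [← fstChart_eq_zero_iff hq]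
  constructor
  · intro h
    have hfst : fstChart w₀ (A.conn S ρ) q = fstChart w₀ (fun w ↦ -ρ w) q :=
      congrArg (fun z ↦ fibCoord F E w₀.proj _ z.1) h
    rwa [hS.fstChart_conn hU hq hqU hframe hρq, fstChart_neg, eq_neg_iff_add_eq_zero,
      ← two_smul ℝ, smul_eq_zero_iff_right two_ne_zero] at hfst
  · intro h
    refine prolField_ext_chart (ρ' := fun w ↦ -ρ w) hq ?_ ?_
    · rw [hS.fstChart_conn hU hq hqU hframe hρq, fstChart_neg, h, neg_zero]
    · rw [hS.sndChart_conn hU hq hqU hframe hρq, sndChart_neg, hρq.sndChart_eq hq, h, map_zero,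
        map_zero, zero_sub, Prod.neg_mk, neg_zero]

theorem isConnectionOn_conn (hU : IsOpen U) (hS : A.IsSemisprayOn U S) :
    A.IsConnectionOn U (A.conn S) where
  isSectionOn _ hρ := hS.isSectionOn_conn hU hρ
  map_add _ _ h₁ h₂ := forall_mem_of_forall_symm (EM := EM) fun _ _ hq hqU hframe ↦
    hS.conn_add_symm hU hq hqU hframe (h₁.isSectionAt hU hqU) (h₂.isSectionAt hU hqU)
  map_smul _ _ hf hρ := forall_mem_of_forall_symm (EM := EM) fun _ _ hq hqU hframe ↦
    hS.conn_smul_symm hU hq hqU hframe (hf.contMDiffAt (hU.mem_nhds hqU)) (hρ.isSectionAt hU hqU)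
  sq _ hρ := hS.conn_conn hU hρ
  ker _ hρ := hS.conn_eq_neg_iff hU hρ

end IsSemisprayOn

end Connection

section Metric

variable {EM : Type*} [NormedAddCommGroup EM] [NormedSpace ℝ EM]
  {M : Type*} [TopologicalSpace M] [ChartedSpace EM M] [IsManifold 𝓘(ℝ, EM) ∞ M]
  {F : Type*} [NormedAddCommGroup F] [NormedSpace ℝ F]
  {E : M → Type*} [TopologicalSpace (TotalSpace F E)]
  [∀ x, AddCommGroup (E x)] [∀ x, Module ℝ (E x)] [∀ x, TopologicalSpace (E x)]
  [FiberBundle F E] [VectorBundle ℝ F E] [ContMDiffVectorBundle ∞ F E 𝓘(ℝ, EM)]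
  {w₀ w : TotalSpace F E} {q : EM × F} {ρ ρ₁ ρ₂ S : ProlField EM F E}
  {U : Set (TotalSpace F E)} {L : TotalSpace F E → ℝ}

local notation "𝓘E" => ModelWithCorners.prod 𝓘(ℝ, EM) 𝓘(ℝ, F)

theorem metric_symm {f₁ f₂ : F} (hq : q ∈ (extChartAt 𝓘E w₀).target)
    (hL : ContDiffAt ℝ 2 (funChart w₀ L) q) (h₁ : sndChart w₀ ρ₁ q = (0, f₁))
    (h₂ : sndChart w₀ ρ₂ q = (0, f₂)) :
    metric L ρ₁ ρ₂ ((extChartAt 𝓘E w₀).symm q) = fibreHessian (funChart w₀ L) q f₁ f₂ := by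
  have hsource := (extChartAt 𝓘E w₀).map_target hq
  rw [metric, fibreHess_symm hq hL, fibCoord_vcomp hsource (congrArg Prod.fst h₁),
    fibCoord_vcomp hsource (congrArg Prod.fst h₂)]
  exact congrArg₂ (fun a b ↦ fibreHessian (funChart w₀ L) q a b) (congrArg Prod.snd h₁)
    (congrArg Prod.snd h₂)

theorem dirDeriv_metric_symm {v₁ v₂ : EM × F → F} (hq : q ∈ (extChartAt 𝓘E w₀).target)
    (hL : ContDiffAt ℝ 3 (funChart w₀ L) q) (hv₁ : DifferentiableAt ℝ v₁ q)
    (hv₂ : DifferentiableAt ℝ v₂ q) (h₁ : ∀ᶠ q' in 𝓝 q, sndChart w₀ ρ₁ q' = (0, v₁ q'))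
    (h₂ : ∀ᶠ q' in 𝓝 q, sndChart w₀ ρ₂ q' = (0, v₂ q')) :
    dirDeriv EM (metric L ρ₁ ρ₂) ((extChartAt 𝓘E w₀).symm q)
        (S ((extChartAt 𝓘E w₀).symm q)).2 =
      fderiv ℝ (fibreHessian (funChart w₀ L)) q (sndChart w₀ S q) (v₁ q) (v₂ q) +
        fibreHessian (funChart w₀ L) q (fderiv ℝ v₁ q (sndChart w₀ S q)) (v₂ q) +
        fibreHessian (funChart w₀ L) q (v₁ q) (fderiv ℝ v₂ q (sndChart w₀ S q)) := by
  have hH : DifferentiableAt ℝ (fibreHessian (funChart w₀ L)) q :=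
    (contDiffAt_fibreHessian (n := 1) hL).differentiableAt one_ne_zero
  have hmetric : metric L ρ₁ ρ₂ ∘ (extChartAt 𝓘E w₀).symm =ᶠ[𝓝 q]
      fun q' ↦ fibreHessian (funChart w₀ L) q' (v₁ q') (v₂ q') := by
    filter_upwards [(isOpen_extChartAt_target w₀).mem_nhds hq, h₁, h₂,
      (hL.of_le (by norm_num : (2 : WithTop ℕ∞) ≤ 3)).eventually (by simp)]
      with q' hq' h₁' h₂' hL'
    exact metric_symm hq' hL' h₁' h₂'
  have hderiv := ((hH.hasFDerivAt.clm_apply hv₁.hasFDerivAt).clm_apply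
    hv₂.hasFDerivAt).congr_of_eventuallyEq hmetric
  rw [dirDeriv_symm hq hderiv.differentiableAt, hderiv.fderiv]
  simp only [add_apply, ContinuousLinearMap.comp_apply, ContinuousLinearMap.flip_apply]
  ring

variable [FiniteDimensional ℝ F] {A : LieAlgebroid EM F E}

theorem IsSectionAt.sndChart_eq_of_vertical (hq : q ∈ (extChartAt 𝓘E w₀).target)
    (h : A.IsSectionAt ((extChartAt 𝓘E w₀).symm q) ρ)
    (hvert : (ρ ((extChartAt 𝓘E w₀).symm q)).1 = 0) :
    sndChart w₀ ρ q = (0, vertChart w₀ ρ q) := by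
  rw [h.sndChart_eq hq, (fstChart_eq_zero_iff hq).2 hvert, map_zero]

theorem IsSectionOn.eventually_sndChart_eq_of_vertical (hU : IsOpen U) (hρ : A.IsSectionOn U ρ)
    (hvert : ∀ w ∈ U, (ρ w).1 = 0) (hq : q ∈ (extChartAt 𝓘E w₀).target)
    (hqU : (extChartAt 𝓘E w₀).symm q ∈ U) :
    ∀ᶠ q' in 𝓝 q, sndChart w₀ ρ q' = (0, vertChart w₀ ρ q') := by
  filter_upwards [eventually_extChartAt_symm_mem hU hq hqU] with q' ⟨hq', hqU'⟩
  exact (hρ.isSectionAt hU hqU').sndChart_eq_of_vertical hq' (hvert _ hqU')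

variable [FiniteDimensional ℝ EM] [T2Space M]

namespace IsSemisprayOn

theorem hproj_conn_of_vertical (hU : IsOpen U) (hS : A.IsSemisprayOn U S)
    (hρ : A.IsSectionOn U ρ) (hvert : ∀ w ∈ U, (ρ w).1 = 0) (hw : w ∈ U) :
    hproj (A.conn S) ρ w = 0 := by
  rw [hproj, (hS.conn_eq_neg_iff hU hρ w hw).2 (hvert w hw), add_neg_cancel, smul_zero]

theorem vproj_conn_of_vertical (hU : IsOpen U) (hS : A.IsSemisprayOn U S)
    (hρ : A.IsSectionOn U ρ) (hvert : ∀ w ∈ U, (ρ w).1 = 0) (hw : w ∈ U) :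
    vproj (A.conn S) ρ w = ρ w := by
  rw [vproj, (hS.conn_eq_neg_iff hU hρ w hw).2 (hvert w hw), sub_neg_eq_add, ← two_smul ℝ,
    smul_smul]
  norm_num

theorem fstChart_prolBracket_of_vertical (hU : IsOpen U) (hS : A.IsSemisprayOn U S)
    (hρ : A.IsSectionOn U ρ) (hvert : ∀ w ∈ U, (ρ w).1 = 0)
    (hq : q ∈ (extChartAt 𝓘E w₀).target) (hqU : (extChartAt 𝓘E w₀).symm q ∈ U)
    (hframe : (extChartAt 𝓘E w₀).symm q ∈ frameDom EM w₀) :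
    fstChart w₀ (A.prolBracket S ρ) q = -vertChart w₀ ρ q := by
  have hfst : fstChart w₀ ρ =ᶠ[𝓝 q] fun _ ↦ 0 := by
    filter_upwards [eventually_extChartAt_symm_mem hU hq hqU] with q' ⟨hq', hqU'⟩
    exact (fstChart_eq_zero_iff hq').2 (hvert _ hqU')
  rw [hS.fstChart_prolBracket hU hq hqU hframe (hρ.isSectionAt hU hqU), hfst.fderiv_eq,
    hfst.self_of_nhds]
  simp

theorem sndChart_prolBracket_of_vertical (hU : IsOpen U) (hS : A.IsSemisprayOn U S)
    (hρ : A.IsSectionOn U ρ) (hvert : ∀ w ∈ U, (ρ w).1 = 0)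
    (hq : q ∈ (extChartAt 𝓘E w₀).target) (hqU : (extChartAt 𝓘E w₀).symm q ∈ U) :
    sndChart w₀ (A.prolBracket S ρ) q = (-A.anchorCoord w₀.proj q.1 (vertChart w₀ ρ q),
      fderiv ℝ (vertChart w₀ ρ) q (sndChart w₀ S q) -
        fderiv ℝ (vertChart w₀ S) q (0, vertChart w₀ ρ q)) := by
  have hv := ((hρ.isSectionAt hU hqU).contDiffAt_vertChart hq).differentiableAt (by simp)
  exact hS.sndChart_prolBracket_of_sndChart_eq hU hq hqU hv.hasFDerivAt
    (hρ.eventually_sndChart_eq_of_vertical hU hvert hq hqU)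

theorem isSectionOn_prolBracket_of_vertical (hU : IsOpen U) (hS : A.IsSemisprayOn U S)
    (hρ : A.IsSectionOn U ρ) (hvert : ∀ w ∈ U, (ρ w).1 = 0) :
    A.IsSectionOn U (A.prolBracket S ρ) := by
  refine (A.isSectionOn_iff_forall_isSectionAt hU).2 <|
    forall_mem_of_forall_symm (EM := EM) fun w₀ q hq hqU hframe ↦ ?_
  have hv := (hρ.isSectionAt hU hqU).contDiffAt_vertChart hq
  have hSq := hS.1.isSectionAt hU hqU
  have hnear := eventually_extChartAt_symm_mem (hU.inter (isOpen_frameDom (EM := EM) w₀)) hq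
    ⟨hqU, hframe⟩
  refine (A.isSectionAt_symm_iff hq).2 ⟨?_, ?_, ?_⟩
  · rw [hS.sndChart_prolBracket_of_vertical hU hρ hvert hq hqU,
      hS.fstChart_prolBracket_of_vertical hU hρ hvert hq hqU hframe, map_neg]
  · refine hv.neg.congr_of_eventuallyEq ?_
    filter_upwards [hnear] with q' ⟨hq', hqU', hframe'⟩
    exact hS.fstChart_prolBracket_of_vertical hU hρ hvert hq' hqU' hframe'
  · have hσ := ((A.contDiffAt_anchorCoord hq).comp q contDiffAt_fst).clm_apply hv
    have hDρ := (hv.fderiv_right (m := ∞) (by simp)).clm_apply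
      ((A.isSectionAt_symm_iff hq).1 hSq).2.2
    have hDS := ((hSq.contDiffAt_vertChart hq).fderiv_right (m := ∞) (by simp)).clm_apply
      ((contDiffAt_const (c := (0 : EM))).prodMk hv)
    refine (hσ.neg.prodMk (hDρ.sub hDS)).congr_of_eventuallyEq ?_
    filter_upwards [hnear] with q' ⟨hq', hqU', _⟩
    exact hS.sndChart_prolBracket_of_vertical hU hρ hvert hq' hqU'

theorem hproj_conn_prolBracket_hproj_conn (hU : IsOpen U) (hS : A.IsSemisprayOn U S)
    (hρ : A.IsSectionOn U ρ) (hvert : ∀ w ∈ U, (ρ w).1 = 0) (hw : w ∈ U) :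
    hproj (A.conn S) (A.prolBracket S (hproj (A.conn S) ρ)) w = 0 := by
  have hzero : ∀ w ∈ U, hproj (A.conn S) ρ w = 0 := fun w hw ↦
    hS.hproj_conn_of_vertical hU hρ hvert hw
  have hzero_fst : ∀ w ∈ U, (hproj (A.conn S) ρ w).1 = 0 := fun w hw ↦ by rw [hzero w hw]; rfl
  have hsection : A.IsSectionOn U (hproj (A.conn S) ρ) :=
    ((A.isSectionOn_zero U).congr hzero)
  refine hS.hproj_conn_of_vertical hU
    (hS.isSectionOn_prolBracket_of_vertical hU hsection hzero_fst) ?_ hw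
  refine forall_mem_of_forall_symm (EM := EM) fun w₀ q hq hqU hframe ↦ ?_
  have hvertChart : vertChart w₀ (hproj (A.conn S) ρ) q = 0 := by
    rw [vertChart, sndChart, chartVectorField, hzero _ hqU]
    exact congrArg Prod.snd (map_zero (chartDeriv 𝓘E w₀ _))
  rw [← fstChart_eq_zero_iff hq,
    hS.fstChart_prolBracket_of_vertical hU hsection hzero_fst hq hqU hframe, hvertChart, neg_zero]

theorem sndChart_vproj_conn (hU : IsOpen U) (hS : A.IsSemisprayOn U S)
    (hρ : A.IsSectionOn U ρ) (hq : q ∈ (extChartAt 𝓘E w₀).target)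
    (hqU : (extChartAt 𝓘E w₀).symm q ∈ U)
    (hframe : (extChartAt 𝓘E w₀).symm q ∈ frameDom EM w₀) :
    sndChart w₀ (vproj (A.conn S) ρ) q =
      (0, vertChart w₀ ρ q - (1 / 2 : ℝ) • A.connCoord w₀ S q (fstChart w₀ ρ q)) := by
  have hsub : sndChart w₀ (vproj (A.conn S) ρ) q =
      (1 / 2 : ℝ) • (sndChart w₀ ρ q - sndChart w₀ (A.conn S ρ) q) :=
    (map_smul (chartDeriv 𝓘E w₀ _) _ _).trans (congrArg _ (map_sub (chartDeriv 𝓘E w₀ _) _ _))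
  have hρq := hρ.isSectionAt hU hqU
  rw [hsub, hS.sndChart_conn hU hq hqU hframe hρq, hρq.sndChart_eq hq, Prod.mk_sub_mk, sub_self,
    Prod.smul_mk, smul_zero]
  congr 1
  module

theorem sndChart_dynCovDeriv_of_vertical (hU : IsOpen U) (hS : A.IsSemisprayOn U S)
    (hρ : A.IsSectionOn U ρ) (hvert : ∀ w ∈ U, (ρ w).1 = 0)
    (hq : q ∈ (extChartAt 𝓘E w₀).target) (hqU : (extChartAt 𝓘E w₀).symm q ∈ U)
    (hframe : (extChartAt 𝓘E w₀).symm q ∈ frameDom EM w₀) :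
    sndChart w₀ (A.dynCovDeriv S (A.conn S) ρ) q =
      (0, fderiv ℝ (vertChart w₀ ρ) q (sndChart w₀ S q) + (1 / 2 : ℝ) •
        (A.structCoord w₀.proj q.1 q.2 (vertChart w₀ ρ q) -
          fderiv ℝ (vertChart w₀ S) q (0, vertChart w₀ ρ q))) := by
  have heq : ∀ w ∈ U, vproj (A.conn S) ρ w = ρ w := fun w hw ↦
    hS.vproj_conn_of_vertical hU hρ hvert hw
  have hsection : A.IsSectionOn U (vproj (A.conn S) ρ) := hρ.congr heq
  have hvert' : ∀ w ∈ U, (vproj (A.conn S) ρ w).1 = 0 := fun w hw ↦ by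
    rw [heq w hw, hvert w hw]
  have hcoord : vertChart w₀ (vproj (A.conn S) ρ) =ᶠ[𝓝 q] vertChart w₀ ρ := by
    filter_upwards [eventually_extChartAt_symm_mem hU hq hqU] with q' ⟨_, hqU'⟩
    rw [vertChart, sndChart, chartVectorField, heq _ hqU']
    rfl
  have hsum : sndChart w₀ (A.dynCovDeriv S (A.conn S) ρ) q =
      sndChart w₀ (vproj (A.conn S) (A.prolBracket S (vproj (A.conn S) ρ))) q := by
    rw [sndChart, chartVectorField, dynCovDeriv,
      hS.hproj_conn_prolBracket_hproj_conn hU hρ hvert hqU, zero_add]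
    rfl
  rw [hsum, hS.sndChart_vproj_conn hU (hS.isSectionOn_prolBracket_of_vertical hU hsection hvert')
    hq hqU hframe, vertChart, hS.sndChart_prolBracket_of_vertical hU hsection hvert' hq hqU,
    hS.fstChart_prolBracket_of_vertical hU hsection hvert' hq hqU hframe, hcoord.fderiv_eq,
    hcoord.self_of_nhds, connCoord]
  simp only [map_neg, add_apply, ContinuousLinearMap.comp_apply, ContinuousLinearMap.inr_apply]
  congr 1
  module

end IsSemisprayOn

namespace IsLagrangianSectionOn

theorem two_mul_fderiv_fibreHessian_sndChart (hU : IsOpen U)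
    (hL : ContMDiffOn 𝓘E 𝓘(ℝ, ℝ) ∞ L U) (hreg : IsRegularOn L U)
    (hS : A.IsLagrangianSectionOn U L S) (hq : q ∈ (extChartAt 𝓘E w₀).target)
    (hqU : (extChartAt 𝓘E w₀).symm q ∈ U)
    (hframe : (extChartAt 𝓘E w₀).symm q ∈ frameDom EM w₀) (a b : F) :
    2 * fderiv ℝ (fibreHessian (funChart w₀ L)) q (sndChart w₀ S q) a b =
      fibreHessian (funChart w₀ L) q
        (A.structCoord w₀.proj q.1 q.2 a - fderiv ℝ (vertChart w₀ S) q (0, a)) b +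
      fibreHessian (funChart w₀ L) q a
        (A.structCoord w₀.proj q.1 q.2 b - fderiv ℝ (vertChart w₀ S) q (0, b)) := by
  have hspray := hS.isSemisprayOn hU hL hreg
  have hLq := (contMDiffAt_symm_iff hq).1 (hL.contMDiffAt (hU.mem_nhds hqU))
  have hEL : ∀ᶠ q' in 𝓝 q, EulerLagrangeAt (A.anchorCoord w₀.proj q'.1)
      (A.structCoord w₀.proj q'.1) (funChart w₀ L) q' (vertChart w₀ S q') := by
    filter_upwards [eventually_extChartAt_symm_mem (hU.inter (isOpen_frameDom (EM := EM) w₀)) hq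
      ⟨hqU, hframe⟩] with q' ⟨hq', hqU', hframe'⟩
    exact (hS.fstChart_eq_and_eulerLagrangeAt hU hL hreg hq' hqU' hframe').2
  have hfibre : ContinuousAt (fun y ↦ (q.1, y)) q.2 := by fun_prop
  have hEL_fibre : ∀ᶠ y in 𝓝 q.2, EulerLagrangeAt (A.anchorCoord w₀.proj q.1)
      (A.structCoord w₀.proj q.1) (funChart w₀ L) (q.1, y) (vertChart w₀ S (q.1, y)) :=
    hfibre.eventually hEL
  have hS' := hasFDerivAt_comp_prodMk_right (hspray.differentiableAt_vertChart hU hq hqU)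
  have hmain := two_mul_fderiv_fibreHessian (A.structCoord_skew w₀.proj q.1)
    (hLq.of_le ENat.LEInfty.out) hS' hEL_fibre a b
  rw [hspray.sndChart_eq hU hq hqU]
  exact hmain

theorem isMetricOn (hU : IsOpen U) (hL : ContMDiffOn 𝓘E 𝓘(ℝ, ℝ) ∞ L U) (hreg : IsRegularOn L U)
    (hS : A.IsLagrangianSectionOn U L S) : A.IsMetricOn U L S (A.conn S) := by
  intro ρ₁ ρ₂ hρ₁ hρ₂ hvert₁ hvert₂
  refine forall_mem_of_forall_symm (EM := EM) fun w₀ q hq hqU hframe ↦ ?_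
  have hspray := hS.isSemisprayOn hU hL hreg
  have hLq := (contMDiffAt_symm_iff hq).1 (hL.contMDiffAt (hU.mem_nhds hqU))
  have hLq₂ : ContDiffAt ℝ 2 (funChart w₀ L) q := hLq.of_le ENat.LEInfty.out
  have h₁ := hρ₁.eventually_sndChart_eq_of_vertical hU hvert₁ hq hqU
  have h₂ := hρ₂.eventually_sndChart_eq_of_vertical hU hvert₂ hq hqU
  have hdiff {ρ} (hρ : A.IsSectionOn U ρ) : DifferentiableAt ℝ (vertChart w₀ ρ) q :=
    ((hρ.isSectionAt hU hqU).contDiffAt_vertChart hq).differentiableAt (by simp)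
  have hSmetric := dirDeriv_metric_symm (S := S) hq (hLq.of_le ENat.LEInfty.out) (hdiff hρ₁)
    (hdiff hρ₂) h₁ h₂
  have hEL := hS.two_mul_fderiv_fibreHessian_sndChart hU hL hreg hq hqU hframe
    (vertChart w₀ ρ₁ q) (vertChart w₀ ρ₂ q)
  rw [dynCovDerivMetric, hSmetric,
    metric_symm hq hLq₂ (hspray.sndChart_dynCovDeriv_of_vertical hU hρ₁ hvert₁ hq hqU hframe)
      h₂.self_of_nhds,
    metric_symm hq hLq₂ h₁.self_of_nhds
      (hspray.sndChart_dynCovDeriv_of_vertical hU hρ₂ hvert₂ hq hqU hframe)]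
  simp only [map_add, map_smul, add_apply, smul_apply, smul_eq_mul]
  linarith

end IsLagrangianSectionOn

end Metric

end LieAlgebroid

end

theorem theorem1p4p1
    {EM : Type*} [NormedAddCommGroup EM] [NormedSpace ℝ EM] [FiniteDimensional ℝ EM]
    {M : Type*} [TopologicalSpace M] [T2Space M] [ChartedSpace EM M] [IsManifold 𝓘(ℝ, EM) ∞ M]
    {F : Type*} [NormedAddCommGroup F] [NormedSpace ℝ F] [FiniteDimensional ℝ F]
    {E : M → Type*} [TopologicalSpace (TotalSpace F E)]
    [∀ x, AddCommGroup (E x)] [∀ x, Module ℝ (E x)] [∀ x, TopologicalSpace (E x)]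
    [FiberBundle F E] [VectorBundle ℝ F E] [ContMDiffVectorBundle ∞ F E 𝓘(ℝ, EM)]
    (A : LieAlgebroid EM F E)
    (U : Set (TotalSpace F E)) (hU : IsOpen U)
    (L : TotalSpace F E → ℝ)
    (hL : ContMDiffOn (𝓘(ℝ, EM).prod 𝓘(ℝ, F)) 𝓘(ℝ, ℝ) ∞ L U)
    (hreg : LieAlgebroid.IsRegularOn L U) :
    (∃ S : LieAlgebroid.ProlField EM F E, A.IsLagrangianSectionOn U L S) ∧
    ∀ S : LieAlgebroid.ProlField EM F E, A.IsLagrangianSectionOn U L S →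
      (∀ S' : LieAlgebroid.ProlField EM F E, A.IsLagrangianSectionOn U L S' → ∀ w ∈ U, S' w = S w) ∧
      A.IsSemisprayOn U S ∧
      A.IsConnectionOn U (A.conn S) ∧
      A.IsMetricOn U L S (A.conn S) := by
  refine ⟨A.exists_isLagrangianSectionOn hU hL hreg, fun S hS ↦ ?_⟩
  have hspray := hS.isSemisprayOn hU hL hreg
  exact ⟨fun _ hS' ↦ hS.eqOn hU hL hreg hS', hspray, hspray.isConnectionOn_conn hU,
    hS.isMetricOn hU hL hreg⟩
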